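/- **Setting.** Consider an untyped call-by-value (right-to-left) $\lambda$-calculus with recursive functions, integers, booleans, pairs, sums, dynamically allocated references and *presampling tapes*. A tape is a finite list of presampled elements of $\{0,\dots,N\}$, for a bound $N$; $\mathsf{tape}\,N$ allocates an empty tape; $\mathsf{rand}\,N\,\alpha$ removes and returns the first element of the tape $\alpha$ if $\alpha$ has bound $N$ and is non-empty, and returns a uniform sample from $\{0,\dots,N\}$ otherwise. Put $\mathsf{flip}\,\alpha := (\mathsf{rand}\,1\,\alpha = 1)$. A state $\sigma$ is a finite heap together with finitely many tapes. Configurations (expression, state) form a Markov chain whose final states are the values. For a Markov chain with final states, $\mathrm{exec}_{\Downarrow}(s)\in[0,1]$ is the probability of reaching a final state from $s$; the chain terminates almost surely from $s$ if it equals $1$. **Program.** Lazily sampled uniform $[0,1]$ reals are implemented by - $\mathsf{init} := \lambda\_.\,(\mathsf{ref}\ \mathsf{None},\ \mathsf{tape}\ 1)$; - $\mathsf{getB} := \lambda \alpha\,\ell.\ \mathsf{match}\ {!\ell}\ \mathsf{with}\ \mathsf{Some}\ v \Rightarrow v \mid \mathsf{None} \Rightarrow \mathsf{let}\ b = \mathsf{flip}\,\alpha\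 \mathsf{in}\ \mathsf{let}\ n = \mathsf{ref}\ \mathsf{None}\ \mathsf{in}\ \mathsf{let}\ v=(b,n)\ \mathsf{in}\ \ell \leftarrow \mathsf{Some}\ v;\ v$; - $\mathsf{cmpB} := \lambda b_1\,b_2.\ \mathsf{if}\ b_1<b_2\ \mathsf{then}\ {-1}\ \mathsf{else}\ (\mathsf{if}\ b_2<b_1\ \mathsf{then}\ 1\ \mathsf{else}\ 0)$; - $\mathsf{rec}\ \mathsf{cmpList}\ \ell_1\,\alpha_1\,\ell_2\,\alpha_2 := \mathsf{let}\ (b_1,n_1)=\mathsf{getB}\,\alpha_1\,\ell_1\ \mathsf{in}\ \mathsf{let}\ (b_2,n_2)=\mathsf{getB}\,\alpha_2\,\ell_2\ \mathsf{in}\ \mathsf{let}\ c=\mathsf{cmpB}\,b_1\,b_2\ \mathsf{in}\ \mathsf{if}\ c=0\ \mathsf{then}\ \mathsf{cmpList}\ n_1\,\alpha_1\,n_2\,\alpha_2\ \mathsf{else}\ c$; - $\mathsf{cmp} := \lambda (\ell_1,\alpha_1)\,(\ell_2,\alpha_2).\ \mathsf{if}\ \ell_1=\ell_2\ \mathsf{then}\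 0\ \mathsf{else}\ \mathsf{cmpList}\ \ell_1\,\alpha_1\,\ell_2\,\alpha_2$. **Model.** The base chain on $\mathbb B\times\mathbb B$ flips two independent fair coins until they differ: a state $(b_1,b_2)$ is final if $b_1\ne b_2$, and otherwise moves to each of the four states with probability $\tfrac14$. The iterated chain on $(\mathbb B\times\mathbb B)\times\mathbb N$ has the final states $(s,0)$; from $(s,n+1)$ it makes a step of the base chain, keeping $n+1$, if $s$ is not final, and it restarts deterministically in $((\top,\top),n)$ if $s$ is final. **Logic.** Assertions are predicates on (step index, resource), closed under smaller indices and larger resources; resources are exclusive fragments of the heap ($\ell\mapsto v$), of the tapes ($\alpha\hookrightarrow(N,\vec n)$) and of the model state ($\mathrm{spec}(m)$), and the authoritative views $S(\sigma)$ of the program state and $G(m)$ of the model state. Connectives, the later modality $\triangleright$, the persistence modality $\Box$ and the update modality $\mathrel{|\!\Rrightarrow}$ are the usual ones of step-indexed separation logic. The refinement weakest precondition $\mathrm{rwp}\,e\,\{\Phi\}$ is the least fixed point of $$(\exists v.\ e=v\wedge \mathrel{|\!\Rrightarrow}\Phi(v))\ \vee\ \bigl(e\notin\mathrm{Val}\wedge\forall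 m,\sigma.\ G(m)*S(\sigma)\mathrel{-\!*}\mathrel{|\!\Rrightarrow}\mathrm{cpl}(m,(e,\sigma))\{m',(e',\sigma').\ \mathrel{|\!\Rrightarrow}G(m')*S(\sigma')*\mathrm{rwp}\,e'\,\{\Phi\}\}\bigr),$$ where $\mathrm{cpl}(m,\rho)\{Z\}$ is the least predicate that holds if for some relation $R$ there is a left-partial $R$-coupling (left marginal exact, right marginal at most the given one, support in $R$) of (1) $\delta_m$ and $\mathrm{step}(\rho)$, with $\rho$ reducible and $\mathrel{|\!\Rrightarrow}Z$ on $R$; or (2) $\mathrm{step}(m)$ and $\mathrm{step}(\rho)$, with $m,\rho$ reducible and $\triangleright\mathrel{|\!\Rrightarrow}Z$ on $R$; or (3) $\mathrm{step}(m)$ and $\delta_\rho$, with $m$ reducible and $\triangleright\mathrel{|\!\Rrightarrow}\mathrm{cpl}(m',\rho)\{Z\}$ for $(m',\rho)\in R$; or (4) $\mathrm{step}(m)$ and the distribution obtained from the state $\sigma$ of $\rho=(e,\sigma)$ by appending uniform samples to a finite list of existing tapes, with $m$ reducible and $\triangleright\mathrel{|\!\Rrightarrow}\mathrm{cpl}(m',(e,\sigma'))\{Z\}$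 for $(m',\sigma')\in R$. The Hoare triple is $\{P\}\,e\,\{\Phi\}:=\Box(P\mathrel{-\!*}\mathrm{rwp}\,e\,\{\Phi\})$. **Predicates.** With the model being the iterated chain, let $\mathit{Cmps}(N):=\exists b,M.\ \mathrm{spec}((b,b),M)\wedge M\ge N$. Let $\mathit{IsList}(\ell,[\,]):=\ell\mapsto\mathsf{None}$ and $\mathit{IsList}(\ell,b::\vec b):=\exists \ell'.\ \ell\mapsto\mathsf{Some}(b,\ell')*\mathit{IsList}(\ell',\vec b)$. Let $\mathit{LazyReal}(\vec b,v):=\exists\ell,\alpha,\vec b_1,\vec b_2.\ v=(\ell,\alpha)*\vec b=\vec b_1\cdot\vec b_2*\mathit{IsList}(\ell,\vec b_1)*\alpha\hookrightarrow(1,\vec b_2)$. **Theorem.** 1. $\vdash\{\mathsf{True}\}\ \mathsf{init}\,()\ \{v.\ \mathit{LazyReal}([\,],v)\}$. 2. For all $N\in\mathbb N$, bit lists $\vec b_1,\vec b_2$ and values $v_1,v_2$, $$\vdash\{\mathit{LazyReal}(\vec b_1,v_1)*\mathit{LazyReal}(\vec b_2,v_2)*\mathit{Cmps}(N+1)\}\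 \mathsf{cmp}\,v_1\,v_2\ \{\_.\ \exists\vec b_1',\vec b_2'.\ \mathit{LazyReal}(\vec b_1\cdot\vec b_1',v_1)*\mathit{LazyReal}(\vec b_2\cdot\vec b_2',v_2)*\mathit{Cmps}(N)\}.$$ 3. The base chain and the iterated chain terminate almost surely from every state. 4. For every $N$, let $e_N$ be the closed program that creates two lazy reals by $\mathsf{init}$ and then calls $\mathsf{cmp}$ on them $N$ times. For every $b\in\mathbb B$, $\mathrm{spec}((b,b),N)\vdash\mathrm{rwp}\,e_N\,\{\mathsf{True}\}$, and for every state $\sigma$, $\mathrm{exec}_{\Downarrow}((b,b),N)\le\mathrm{exec}_{\Downarrow}(e_N,\sigma)=1$. 5. Let $\sigma$ be a state such that the ownership of all of its heap and tapes satisfies $\mathit{LazyReal}(\vec b_1,v_1)*\mathit{LazyReal}(\vec b_2,v_2)$. Then $\mathrm{exec}_{\Downarrow}(b,b)\le\mathrm{exec}_{\Downarrow}(\mathsf{cmp}\,v_1\,v_2,\sigma)=1$ for every $b\in\mathbb B$, with the base chain on the left; in particular the comparison terminates almost surely. -/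

import Mathlib

open scoped ENNReal

noncomputable section

/-! ## Discrete sub-distributions and left-partial couplings -/

/-- A discrete probability sub-distribution on `A`. -/
structure SubDistr (A : Type*) where
  mass : A → ℝ≥0∞
  sum_le : ∑' a, mass a ≤ 1

namespace SubDistr

variable {A B : Type*}

def zero : SubDistr A := ⟨fun _ => 0, by simp⟩

open Classical in
/-- The Dirac distribution. -/
def ret (a : A) : SubDistr A := ⟨fun a' => if a' = a then 1 else 0, by simp⟩

theorem mass_le_one (μ : SubDistr A) (a : A) : μ.mass a ≤ 1 :=
  (ENNReal.le_tsum a).trans μ.sum_le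

def bind (μ : SubDistr A) (f : A → SubDistr B) : SubDistr B :=
  ⟨fun b => ∑' a, μ.mass a * (f a).mass b, by
    rw [ENNReal.tsum_comm]
    refine le_trans (ENNReal.tsum_le_tsum fun a => ?_) μ.sum_le
    rw [ENNReal.tsum_mul_left]
    exact mul_le_of_le_one_right' (f a).sum_le⟩

def map (f : A → B) (μ : SubDistr A) : SubDistr B := μ.bind fun a => ret (f a)

/-- The uniform distribution on a finite type. -/
def unif (A : Type*) [Fintype A] : SubDistr A :=
  ⟨fun _ => (Fintype.card A : ℝ≥0∞)⁻¹, by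
    simp [tsum_fintype, ENNReal.mul_inv_le_one]⟩

/-- `Coupl μ₁ μ₂ R`: there is a left-partial `R`-coupling of `μ₁` and `μ₂`. -/
def Coupl (μ₁ : SubDistr A) (μ₂ : SubDistr B) (R : A → B → Prop) : Prop :=
  ∃ μ : SubDistr (A × B),
    (∀ a, ∑' b, μ.mass (a, b) = μ₁.mass a) ∧
    (∀ b, ∑' a, μ.mass (a, b) ≤ μ₂.mass b) ∧
    ∀ a b, 0 < μ.mass (a, b) → R a b

end SubDistr

/-! ## Markov chains -/

/-- A (sub-)Markov chain with a set of final states, which have no outgoing transitions. -/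
structure MarkovChain (S : Type*) where
  step : S → SubDistr S
  final : S → Prop
  step_final : ∀ s, final s → ∀ s', (step s).mass s' = 0

namespace MarkovChain

variable {S : Type*} (M : MarkovChain S)

def Red (s : S) : Prop := ∃ s', 0 < (M.step s).mass s'

open Classical in
/-- The distribution of the final state reached in at most `n` steps. -/
def execN : ℕ → S → SubDistr S
  | 0, s => if M.final s then SubDistr.ret s else SubDistr.zero
  | n + 1, s => if M.final s then SubDistr.ret s else (M.step s).bind (execN n)

/-- The probability of reaching the final state `s'` from `s`: the limit of the non-decreasing
sequence `execN n s s'`. -/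
def exec (s s' : S) : ℝ≥0∞ := ⨆ n, (M.execN n s).mass s'

/-- The probability that an execution from `s` terminates. -/
def execTerm (s : S) : ℝ≥0∞ := ∑' s', M.exec s s'

open Classical in
/-- Iterations of a chain. In state `(s, n)` there are `n` iterations left, the current one being in
state `s`. When the current iteration is over, the chain restarts in `s₀` with one iteration less. -/
def iterate (s₀ : S) : MarkovChain (S × ℕ) where
  step p := match p with
    | (_, 0) => SubDistr.zero
    | (s, n + 1) =>
      if M.final s then SubDistr.ret (s₀, n) else (M.step s).map fun s' => (s', n + 1)
  final p := p.2 = 0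
  step_final := by
    rintro ⟨s, n⟩ h s'
    cases n with
    | zero => rfl
    | succ n => simp at h

end MarkovChain

/-- Flip two coins until they differ. -/
def coinChain : MarkovChain (Bool × Bool) where
  step p := if p.1 = p.2 then SubDistr.unif (Bool × Bool) else SubDistr.zero
  final p := p.1 ≠ p.2
  step_final p h s' := by rw [if_neg h]; rfl

abbrev CmpState : Type := (Bool × Bool) × ℕ

/-- The iterated model; the number is the number of comparisons that are left. -/
def cmpChain : MarkovChain CmpState := coinChain.iterate (true, true)

/-! ## The programming language -/

abbrev Loc : Type := ℕ
abbrev Label : Type := ℕ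
/-- Program variables. -/
abbrev Var : Type := ℕ
/-- A binder is a variable or anonymous. -/
abbrev Binder : Type := Option Var

inductive BinOp where
  | add | sub | mul | eq | lt | le

inductive Lit where
  | int (z : ℤ)
  | bool (b : Bool)
  | unit
  | loc (l : Loc)
  | lbl (α : Label)

mutual
inductive Val where
  | lit (c : Lit)
  | recV (f x : Binder) (e : Expr)
  | pairV (v w : Val)
  | inlV (v : Val)
  | inrV (v : Val)

inductive Expr where
  | val (v : Val)
  | var (x : Var)
  | recE (f x : Binder) (e : Expr)
  | app (e₁ e₂ : Expr)
  | binOp (op : BinOp) (e₁ e₂ : Expr)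
  | ite (e e₁ e₂ : Expr)
  | pair (e₁ e₂ : Expr)
  | fst (e : Expr)
  | snd (e : Expr)
  | inl (e : Expr)
  | inr (e : Expr)
  | case (e : Expr) (x₁ : Binder) (e₁ : Expr) (x₂ : Binder) (e₂ : Expr)
  | alloc (e : Expr)
  | load (e : Expr)
  | store (e₁ e₂ : Expr)
  | allocTape (e : Expr)
  | rand (e : Expr)
  | randT (e₁ e₂ : Expr)
end

/-- A presampling tape: a bound `N` and a list of presampled elements of `{0, …, N}`. -/
structure Tape where
  bound : ℕ
  vals : List (Fin (bound + 1))

/-- A program state: a finite heap and finitely many tapes. -/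
structure State where
  heap : Finmap fun _ : Loc => Val
  tapes : Finmap fun _ : Label => Tape

abbrev Conf : Type := Expr × State

namespace State

def setHeap (σ : State) (l : Loc) (v : Val) : State := { σ with heap := σ.heap.insert l v }

def setTape (σ : State) (α : Label) (t : Tape) : State := { σ with tapes := σ.tapes.insert α t }

def freshLoc (σ : State) : Loc := σ.heap.keys.sup id + 1

def freshLabel (σ : State) : Label := σ.tapes.keys.sup id + 1

/-- Presampling: append a uniform sample at the end of the tape `α`. -/
def presample (σ : State) (α : Label) : SubDistr State :=
  match σ.tapes.lookup α with
  | none => SubDistr.zero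
  | some t => (SubDistr.unif (Fin (t.bound + 1))).map fun n =>
      σ.setTape α ⟨t.bound, t.vals ++ [n]⟩

/-- The monadic fold of `presample` over a list of labels. -/
def presamples (σ : State) : List Label → SubDistr State
  | [] => SubDistr.ret σ
  | α :: l => (σ.presample α).bind fun σ' => presamples σ' l

end State

def Val.int (z : ℤ) : Val := .lit (.int z)
def Val.bool (b : Bool) : Val := .lit (.bool b)
def Val.unit : Val := .lit .unit
def Val.loc (l : Loc) : Val := .lit (.loc l)
def Val.lbl (α : Label) : Val := .lit (.lbl α)
def Val.noneV : Val := .inlV .unit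
def Val.someV (v : Val) : Val := .inrV v

/-- Comparison of literals for equality; the language does not compare other values. -/
def Lit.beq : Lit → Lit → Bool
  | .int a, .int b => a == b
  | .bool a, .bool b => a == b
  | .unit, .unit => true
  | .loc a, .loc b => a == b
  | .lbl a, .lbl b => a == b
  | _, _ => false

def BinOp.eval : BinOp → Val → Val → Option Val
  | .eq, .lit a, .lit b => some (.bool (a.beq b))
  | .add, .lit (.int a), .lit (.int b) => some (.int (a + b))
  | .sub, .lit (.int a), .lit (.int b) => some (.int (a - b))
  | .mul, .lit (.int a), .lit (.int b) => some (.int (a * b))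
  | .lt, .lit (.int a), .lit (.int b) => some (.bool (decide (a < b)))
  | .le, .lit (.int a), .lit (.int b) => some (.bool (decide (a ≤ b)))
  | .lt, .lit (.bool a), .lit (.bool b) => some (.bool (!a && b))
  | .le, .lit (.bool a), .lit (.bool b) => some (.bool (!a || b))
  | _, _, _ => none

namespace Expr

def toVal : Expr → Option Val
  | val v => some v
  | _ => none

/-- Substitution of the (closed) value `v` for the variable `y`. -/
def subst (y : Var) (v : Val) : Expr → Expr
  | val w => val w
  | var x => if x = y then val v else var x
  | recE f x e => if f = some y ∨ x = some y then recE f x e else recE f x (subst y v e)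
  | app e₁ e₂ => app (subst y v e₁) (subst y v e₂)
  | binOp op e₁ e₂ => binOp op (subst y v e₁) (subst y v e₂)
  | ite e e₁ e₂ => ite (subst y v e) (subst y v e₁) (subst y v e₂)
  | pair e₁ e₂ => pair (subst y v e₁) (subst y v e₂)
  | fst e => fst (subst y v e)
  | snd e => snd (subst y v e)
  | inl e => inl (subst y v e)
  | inr e => inr (subst y v e)
  | case e x₁ e₁ x₂ e₂ =>
      case (subst y v e) x₁ (if x₁ = some y then e₁ else subst y v e₁)
        x₂ (if x₂ = some y then e₂ else subst y v e₂)
  | alloc e => alloc (subst y v e)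
  | load e => load (subst y v e)
  | store e₁ e₂ => store (subst y v e₁) (subst y v e₂)
  | allocTape e => allocTape (subst y v e)
  | rand e => rand (subst y v e)
  | randT e₁ e₂ => randT (subst y v e₁) (subst y v e₂)

def substB (x : Binder) (v : Val) (e : Expr) : Expr :=
  match x with
  | none => e
  | some y => subst y v e

end Expr

/-- One-layer evaluation contexts; evaluation is call-by-value, from right to left. -/
inductive ECtxItem where
  | appR (e₁ : Expr)
  | appL (v₂ : Val)
  | binOpR (op : BinOp) (e₁ : Expr)
  | binOpL (op : BinOp) (v₂ : Val)
  | ite (e₁ e₂ : Expr)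
  | pairR (e₁ : Expr)
  | pairL (v₂ : Val)
  | fst
  | snd
  | inl
  | inr
  | case (x₁ : Binder) (e₁ : Expr) (x₂ : Binder) (e₂ : Expr)
  | alloc
  | load
  | storeR (e₁ : Expr)
  | storeL (v₂ : Val)
  | allocTape
  | rand
  | randTR (e₁ : Expr)
  | randTL (v₂ : Val)

def ECtxItem.fill : ECtxItem → Expr → Expr
  | appR e₁, e => .app e₁ e
  | appL v₂, e => .app e (.val v₂)
  | binOpR op e₁, e => .binOp op e₁ e
  | binOpL op v₂, e => .binOp op e (.val v₂)
  | ite e₁ e₂, e => .ite e e₁ e₂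
  | pairR e₁, e => .pair e₁ e
  | pairL v₂, e => .pair e (.val v₂)
  | fst, e => .fst e
  | snd, e => .snd e
  | inl, e => .inl e
  | inr, e => .inr e
  | case x₁ e₁ x₂ e₂, e => .case e x₁ e₁ x₂ e₂
  | alloc, e => .alloc e
  | load, e => .load e
  | storeR e₁, e => .store e₁ e
  | storeL v₂, e => .store e (.val v₂)
  | allocTape, e => .allocTape e
  | rand, e => .rand e
  | randTR e₁, e => .randT e₁ e
  | randTL v₂, e => .randT e (.val v₂)

namespace Expr

/-- Focus on the argument of a unary construct unless it is a value. -/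
def focus (K : ECtxItem) (e : Expr) : Option (ECtxItem × Expr) :=
  match e.toVal with
  | some _ => none
  | none => some (K, e)

/-- Focus on the second argument of a binary construct, or on the first one if the second is a
value, or on nothing if both are values. -/
def focus₂ (KR : ECtxItem) (KL : Val → ECtxItem) (e₁ e₂ : Expr) : Option (ECtxItem × Expr) :=
  match e₂.toVal with
  | some v₂ => focus (KL v₂) e₁
  | none => some (KR, e₂)

/-- The outermost layer of the evaluation context around the next redex of an expression. -/
def decompItem : Expr → Option (ECtxItem × Expr)
  | val _ => none
  | var _ => none
  | recE _ _ _ => none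
  | app e₁ e₂ => focus₂ (.appR e₁) .appL e₁ e₂
  | binOp op e₁ e₂ => focus₂ (.binOpR op e₁) (.binOpL op) e₁ e₂
  | ite e e₁ e₂ => focus (.ite e₁ e₂) e
  | pair e₁ e₂ => focus₂ (.pairR e₁) .pairL e₁ e₂
  | fst e => focus .fst e
  | snd e => focus .snd e
  | inl e => focus .inl e
  | inr e => focus .inr e
  | case e x₁ e₁ x₂ e₂ => focus (.case x₁ e₁ x₂ e₂) e
  | alloc e => focus .alloc e
  | load e => focus .load e
  | store e₁ e₂ => focus₂ (.storeR e₁) .storeL e₁ e₂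
  | allocTape e => focus .allocTape e
  | rand e => focus .rand e
  | randT e₁ e₂ => focus₂ (.randTR e₁) .randTL e₁ e₂

theorem decompItem_sizeOf {e e' : Expr} {K : ECtxItem} (h : e.decompItem = some (K, e')) :
    sizeOf e' < sizeOf e := by
  cases e <;> simp only [decompItem, focus₂, focus, reduceCtorEq] at h <;>
    (repeat' split at h) <;>
    first
      | (exfalso; simp at h; done)
      | (simp only [Option.some.injEq, Prod.mk.injEq] at h
         obtain ⟨-, rfl⟩ := h
         simp
         try omega)

/-- Sampling from `{0, …, N}`. -/
def sample (N : ℕ) (σ : State) : SubDistr Conf :=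
  (SubDistr.unif (Fin (N + 1))).map fun n => (val (.int (n.val : ℤ)), σ)

/-- Reduction of a redex. Expressions that are not a redex have no transition. -/
def headStep : Expr → State → SubDistr Conf
  | recE f x e, σ => .ret (val (.recV f x e), σ)
  | app (val (.recV f x e)) (val v), σ =>
      .ret (substB x v (substB f (.recV f x e) e), σ)
  | binOp op (val v) (val w), σ =>
      match op.eval v w with
      | some u => .ret (val u, σ)
      | none => .zero
  | ite (val (.lit (.bool b))) e₁ e₂, σ => .ret (if b then e₁ else e₂, σ)
  | pair (val v) (val w), σ => .ret (val (.pairV v w), σ)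
  | fst (val (.pairV v _)), σ => .ret (val v, σ)
  | snd (val (.pairV _ w)), σ => .ret (val w, σ)
  | inl (val v), σ => .ret (val (.inlV v), σ)
  | inr (val v), σ => .ret (val (.inrV v), σ)
  | case (val (.inlV v)) x₁ e₁ _ _, σ => .ret (substB x₁ v e₁, σ)
  | case (val (.inrV v)) _ _ x₂ e₂, σ => .ret (substB x₂ v e₂, σ)
  | alloc (val v), σ => .ret (val (.loc σ.freshLoc), σ.setHeap σ.freshLoc v)
  | load (val (.lit (.loc l))), σ =>
      match σ.heap.lookup l with
      | some v => .ret (val v, σ)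
      | none => .zero
  | store (val (.lit (.loc l))) (val w), σ =>
      match σ.heap.lookup l with
      | some _ => .ret (val .unit, σ.setHeap l w)
      | none => .zero
  | allocTape (val (.lit (.int (.ofNat N)))), σ =>
      .ret (val (.lbl σ.freshLabel), σ.setTape σ.freshLabel ⟨N, []⟩)
  | rand (val (.lit (.int (.ofNat N)))), σ => sample N σ
  | randT (val (.lit (.int (.ofNat N)))) (val (.lit (.lbl α))), σ =>
      match σ.tapes.lookup α with
      | none => .zero
      | some t =>
          if t.bound = N then
            match t.vals with
            | [] => sample N σ
            | n :: ns => .ret (val (.int (n.val : ℤ)), σ.setTape α ⟨t.bound, ns⟩)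
          else sample N σ
  | _, _ => .zero

/-- The transitions of an expression: reduce the redex in its evaluation context. -/
def step (e : Expr) (σ : State) : SubDistr Conf :=
  match h : e.decompItem with
  | some (K, e') => (step e' σ).map fun ρ => (K.fill ρ.1, ρ.2)
  | none => headStep e σ
termination_by sizeOf e
decreasing_by exact decompItem_sizeOf h

theorem step_val (v : Val) (σ : State) : step (val v) σ = .zero := by
  rw [step]; rfl

end Expr

/-- The Markov chain semantics of the language. -/
def langChain : MarkovChain Conf where
  step ρ := ρ.1.step ρ.2
  final ρ := ∃ v, ρ.1 = .val v
  step_final := by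
    rintro ⟨e, σ⟩ ⟨v, rfl⟩ ρ
    simp only [Expr.step_val]
    rfl

/-! ### Syntactic sugar -/

namespace Expr

def lam (x : Binder) (e : Expr) : Expr := recE none x e
def letE (x : Binder) (e₁ e₂ : Expr) : Expr := app (lam x e₂) e₁
def seq (e₁ e₂ : Expr) : Expr := letE none e₁ e₂
def int (z : ℤ) : Expr := val (.int z)
def unit : Expr := val .unit
def noneE : Expr := val .noneV
def someE (e : Expr) : Expr := inr e
/-- The result of a coin flip, sampled through the tape `e`. -/
def flipT (e : Expr) : Expr := binOp .eq (randT (int 1) e) (int 1)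

end Expr

def Val.lam (x : Binder) (e : Expr) : Val := .recV none x e

/-! ## The lazy real library -/

namespace LazyRealCode

/-! Variable names. -/
def f : Var := 0
def l₁ : Var := 1
def a₁ : Var := 2
def l₂ : Var := 3
def a₂ : Var := 4
def p₁ : Var := 5
def p₂ : Var := 6
def b₁ : Var := 7
def n₁ : Var := 8
def b₂ : Var := 9
def n₂ : Var := 10
def c : Var := 11
def v₁ : Var := 12
def v₂ : Var := 13

open Expr

/-- `λ _. (alloc None, allocTape 1)` -/
def init : Val := .lam none (pair (alloc noneE) (allocTape (int 1)))

/-- `λ b₁ b₂. if b₁ < b₂ then -1 else (if b₂ < b₁ then 1 else 0)` -/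
def cmpB : Val :=
  .lam (some b₁) <| lam (some b₂) <|
    ite (binOp .lt (var b₁) (var b₂)) (int (-1))
      (ite (binOp .lt (var b₂) (var b₁)) (int 1) (int 0))

/-- `λ a l. match !l with Some v => v | None => let b = flip a in let n = alloc None in
let v = (b, n) in l ← Some v; v` -/
def getB : Val :=
  .lam (some a₁) <| lam (some l₁) <|
    case (load (var l₁))
      none
      (letE (some b₁) (flipT (var a₁)) <|
       letE (some n₁) (alloc noneE) <|
       letE (some v₁) (pair (var b₁) (var n₁)) <|
       seq (store (var l₁) (someE (var v₁))) (var v₁))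
      (some v₁)
      (var v₁)

/-- `rec f l₁ a₁ l₂ a₂. let (b₁, n₁) = getB a₁ l₁ in let (b₂, n₂) = getB a₂ l₂ in
let c = cmpB b₁ b₂ in if c == 0 then f n₁ a₁ n₂ a₂ else c` -/
def cmpList : Val :=
  .recV (some f) (some l₁) <| lam (some a₁) <| lam (some l₂) <| lam (some a₂) <|
    letE (some p₁) (app (app (val getB) (var a₁)) (var l₁)) <|
    letE (some b₁) (fst (var p₁)) <| letE (some n₁) (snd (var p₁)) <|
    letE (some p₂) (app (app (val getB) (var a₂)) (var l₂)) <|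
    letE (some b₂) (fst (var p₂)) <| letE (some n₂) (snd (var p₂)) <|
    letE (some c) (app (app (val cmpB) (var b₁)) (var b₂)) <|
    ite (binOp .eq (var c) (int 0))
      (app (app (app (app (var f) (var n₁)) (var a₁)) (var n₂)) (var a₂))
      (var c)

/-- `λ (l₁, a₁) (l₂, a₂). if l₁ == l₂ then 0 else cmpList l₁ a₁ l₂ a₂` -/
def cmp : Val :=
  .lam (some v₁) <| lam (some v₂) <|
    letE (some l₁) (fst (var v₁)) <| letE (some a₁) (snd (var v₁)) <|
    letE (some l₂) (fst (var v₂)) <| letE (some a₂) (snd (var v₂)) <|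
    ite (binOp .eq (var l₁) (var l₂)) (int 0)
      (app (app (app (app (val cmpList) (var l₁)) (var a₁)) (var l₂)) (var a₂))

def initCall : Expr := app (val init) unit

def cmpCall (v w : Val) : Expr := app (app (val cmp) (val v)) (val w)

/-- `cmp v₁ v₂; …; cmp v₁ v₂; ()` with `N` calls, for the program variables `v₁`, `v₂`. -/
def cmpTimes : ℕ → Expr
  | 0 => unit
  | N + 1 => seq (app (app (val cmp) (var v₁)) (var v₂)) (cmpTimes N)

/-- A closed program that creates two lazy reals and compares them `N` times. -/
def client (N : ℕ) : Expr :=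
  letE (some v₁) initCall <| letE (some v₂) initCall <| cmpTimes N

end LazyRealCode

/-! ## Resources

The resource algebra of the logic: exclusive fragments of the heap, of the tapes and of the model
state, together with the authoritative views of the program state and of the model state. -/

/-- The exclusive resource algebra with a unit: nothing, exclusive ownership, or an invalid
element. -/
inductive Excl (A : Type*) where
  | nil
  | own (a : A)
  | bot

namespace Excl

variable {A : Type*}

def op : Excl A → Excl A → Excl A
  | nil, y => y
  | x, nil => x
  | _, _ => bot

instance : CommMonoid (Excl A) where
  mul := op
  one := nil
  mul_assoc x y z := by cases x <;> cases y <;> cases z <;> rfl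
  one_mul x := by cases x <;> rfl
  mul_one x := by cases x <;> rfl
  mul_comm x y := by cases x <;> cases y <;> rfl

def ofOption : Option A → Excl A
  | none => nil
  | some a => own a

/-- The fragment `x` is valid and contained in `o`. -/
def AgreesWith : Excl A → Option A → Prop
  | nil, _ => True
  | own a, o => o = some a
  | bot, _ => False

end Excl

@[ext]
structure Res (S : Type) where
  heap : Loc → Excl Val
  tapes : Label → Excl Tape
  spec : Excl S
  authState : Excl State
  authSpec : Excl S

namespace Res

variable {S : Type}

instance : CommMonoid (Res S) where
  mul x y := ⟨x.heap * y.heap, x.tapes * y.tapes, x.spec * y.spec,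
    x.authState * y.authState, x.authSpec * y.authSpec⟩
  one := ⟨1, 1, 1, 1, 1⟩
  mul_assoc x y z := Res.ext (mul_assoc _ _ _) (mul_assoc _ _ _) (mul_assoc _ _ _)
    (mul_assoc _ _ _) (mul_assoc _ _ _)
  one_mul x := Res.ext (one_mul _) (one_mul _) (one_mul _) (one_mul _) (one_mul _)
  mul_one x := Res.ext (mul_one _) (mul_one _) (mul_one _) (mul_one _) (mul_one _)
  mul_comm x y := Res.ext (mul_comm _ _) (mul_comm _ _) (mul_comm _ _) (mul_comm _ _)
    (mul_comm _ _)

/-- A resource is valid if it has no conflicting ownership and its fragments agree with the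
authoritative views, as far as it holds those. -/
def Valid (r : Res S) : Prop :=
  ∃ (σ : State) (m : S),
    (∀ l, (r.heap l).AgreesWith (σ.heap.lookup l)) ∧
    (∀ α, (r.tapes α).AgreesWith (σ.tapes.lookup α)) ∧
    r.spec.AgreesWith (some m) ∧
    r.authState.AgreesWith (some σ) ∧
    r.authSpec.AgreesWith (some m)

theorem Valid.of_mul {x y : Res S} (h : (x * y).Valid) : x.Valid := by
  have key : ∀ {A : Type} (a b : Excl A) (o : Option A),
      (a * b).AgreesWith o → a.AgreesWith o := by
    intro A a b o hab
    cases a <;> cases b <;> first | exact hab | trivial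
  obtain ⟨σ, m, h₁, h₂, h₃, h₄, h₅⟩ := h
  exact ⟨σ, m, fun l => key _ _ _ (h₁ l), fun α => key _ _ _ (h₂ α), key _ _ _ h₃,
    key _ _ _ h₄, key _ _ _ h₅⟩

/-- The ownership of everything in a program state. -/
def ofState (σ : State) : Res S where
  heap l := .ofOption (σ.heap.lookup l)
  tapes α := .ofOption (σ.tapes.lookup α)
  spec := 1
  authState := 1
  authSpec := 1

end Res

/-! ## The step-indexed base logic -/

/-- Propositions: predicates on step indices and resources, closed under smaller indices and larger
resources. -/
structure IProp (S : Type) where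
  holds : ℕ → Res S → Prop
  mono : ∀ {n k : ℕ} {x : Res S} (z : Res S), k ≤ n → holds n x → holds k (x * z)

namespace IProp

variable {S : Type}

def Entails (P Q : IProp S) : Prop := ∀ n x, x.Valid → P.holds n x → Q.holds n x

def pure (φ : Prop) : IProp S := ⟨fun _ _ => φ, fun _ _ h => h⟩

/-- `⊢ P` -/
def Provable (P : IProp S) : Prop := Entails (pure True) P

def and (P Q : IProp S) : IProp S :=
  ⟨fun n x => P.holds n x ∧ Q.holds n x, fun z hk h => ⟨P.mono z hk h.1, Q.mono z hk h.2⟩⟩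

def or (P Q : IProp S) : IProp S :=
  ⟨fun n x => P.holds n x ∨ Q.holds n x, fun z hk h => h.imp (P.mono z hk) (Q.mono z hk)⟩

def all {ι : Sort*} (P : ι → IProp S) : IProp S :=
  ⟨fun n x => ∀ i, (P i).holds n x, fun z hk h i => (P i).mono z hk (h i)⟩

def ex {ι : Sort*} (P : ι → IProp S) : IProp S :=
  ⟨fun n x => ∃ i, (P i).holds n x, fun z hk ⟨i, h⟩ => ⟨i, (P i).mono z hk h⟩⟩

/-- Separating conjunction. -/
def sep (P Q : IProp S) : IProp S :=
  ⟨fun n x => ∃ x₁ x₂, x = x₁ * x₂ ∧ P.holds n x₁ ∧ Q.holds n x₂, by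
    rintro n k x z hk ⟨x₁, x₂, rfl, hP, hQ⟩
    exact ⟨x₁, x₂ * z, mul_assoc _ _ _, by simpa using P.mono 1 hk hP, Q.mono z hk hQ⟩⟩

/-- Separating implication. -/
def wand (P Q : IProp S) : IProp S :=
  ⟨fun n x => ∀ k ≤ n, ∀ y, (x * y).Valid → P.holds k y → Q.holds k (x * y), by
    intro n k x z hk h j hj y hv hP
    rw [mul_right_comm] at hv ⊢
    exact Q.mono z le_rfl (h j (hj.trans hk) y hv.of_mul hP)⟩

/-- The later modality. -/
def later (P : IProp S) : IProp S :=
  ⟨fun n x => ∀ k < n, P.holds k x, fun z hk h j hj =>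
    P.mono z le_rfl (h j (hj.trans_le hk))⟩

/-- The persistence modality; the only duplicable resource is the unit. -/
def always (P : IProp S) : IProp S :=
  ⟨fun n _ => P.holds n 1, fun _ hk h => by simpa using P.mono 1 hk h⟩

/-- The update modality. -/
def upd (P : IProp S) : IProp S :=
  ⟨fun n x => ∀ k ≤ n, ∀ y, (x * y).Valid → ∃ x', (x' * y).Valid ∧ P.holds k x', by
    intro n k x z hk h j hj y hv
    rw [mul_assoc] at hv
    obtain ⟨x', hv', hP⟩ := h j (hj.trans hk) _ hv
    exact ⟨x' * z, by rwa [mul_assoc], P.mono z le_rfl hP⟩⟩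

/-- Ownership of a resource. -/
def own (r : Res S) : IProp S :=
  ⟨fun _ x => ∃ z, x = r * z, by
    rintro n k x z - ⟨y, rfl⟩
    exact ⟨y * z, mul_assoc _ _ _⟩⟩

/-- The least fixed point of a (monotone) map of predicates: the meet of all its pre-fixed
points. -/
def lfp {ι : Type} (F : (ι → IProp S) → ι → IProp S) (i : ι) : IProp S :=
  ⟨fun n x => ∀ W : ι → IProp S, (∀ j, Entails (F W j) (W j)) → (W i).holds n x,
    fun z hk h W hW => (W i).mono z hk (h W hW)⟩

/-- `l ↦ v` -/
def pointsTo (l : Loc) (v : Val) : IProp S :=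
  own { (1 : Res S) with heap := Pi.mulSingle l (Excl.own v) }

/-- `α ↪ (N, ns)`, the ownership of a tape -/
def tapeOwn (α : Label) (t : Tape) : IProp S :=
  own { (1 : Res S) with tapes := Pi.mulSingle α (Excl.own t) }

/-- Ownership of the model, which is in state `m`. -/
def spec (m : S) : IProp S := own { (1 : Res S) with spec := Excl.own m }

/-- The authoritative view of the program state. -/
def stateInterp (σ : State) : IProp S := own { (1 : Res S) with authState := Excl.own σ }

/-- The authoritative view of the model state. -/
def specInterp (m : S) : IProp S := own { (1 : Res S) with authSpec := Excl.own m }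

/-! ## The refinement weakest precondition

The update modality stands where ghost resources may be updated. -/

/-- The four rules of the coupling precondition with postcondition `Z`; `W` is the recursive
occurrence. -/
def cplF (M : MarkovChain S) (Z : S → Conf → IProp S) (W : S × Conf → IProp S) :
    S × Conf → IProp S
  | (m, ρ) =>
    -- a step of the program
    or (ex fun R : S → Conf → Prop =>
      and (pure (langChain.Red ρ ∧ (SubDistr.ret m).Coupl (langChain.step ρ) R))
        (all fun m' => all fun ρ' => all fun _ : R m' ρ' => upd (Z m' ρ'))) <|
    -- a step of the model coupled with a step of the program
    or (ex fun R : S → Conf → Prop =>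
      and (pure (langChain.Red ρ ∧ M.Red m ∧ (M.step m).Coupl (langChain.step ρ) R))
        (all fun m' => all fun ρ' => all fun _ : R m' ρ' => later (upd (Z m' ρ')))) <|
    -- a step of the model
    or (ex fun R : S → Conf → Prop =>
      and (pure (M.Red m ∧ (M.step m).Coupl (SubDistr.ret ρ) R))
        (all fun m' => all fun _ : R m' ρ => later (upd (W (m', ρ))))) <|
    -- a step of the model coupled with presamplings
    ex fun R : S → State → Prop => ex fun l : List Label =>
      and (pure (M.Red m ∧ (∀ α ∈ l, α ∈ ρ.2.tapes) ∧
          (M.step m).Coupl (ρ.2.presamples l) R))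
        (all fun m' => all fun σ' => all fun _ : R m' σ' => later (upd (W (m', (ρ.1, σ')))))

/-- The coupling precondition. -/
def execCoupl (M : MarkovChain S) (m : S) (ρ : Conf) (Z : S → Conf → IProp S) : IProp S :=
  lfp (cplF M Z) (m, ρ)

def rwpF (M : MarkovChain S) (Φ : Val → IProp S) (W : Expr → IProp S) (e : Expr) : IProp S :=
  or (ex fun v : Val => and (pure (e = .val v)) (upd (Φ v)))
    (and (pure (∀ v, e ≠ .val v))
      (all fun m => all fun σ =>
        wand (sep (specInterp m) (stateInterp σ))
          (upd (execCoupl M m (e, σ) fun m' ρ' =>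
            upd (sep (specInterp m') (sep (stateInterp ρ'.2) (W ρ'.1)))))))

/-- The refinement weakest precondition of `e` with postcondition `Φ`, for the model `M`. -/
def rwp (M : MarkovChain S) (e : Expr) (Φ : Val → IProp S) : IProp S := lfp (rwpF M Φ) e

/-- The Hoare triple `{P} e {Φ}`. -/
def hoare (M : MarkovChain S) (P : IProp S) (e : Expr) (Φ : Val → IProp S) : IProp S :=
  always (wand P (rwp M e Φ))

/-! ### The maps above are monotone, so the least fixed points exist -/

theorem upd_mono {P Q : IProp S} (h : Entails P Q) : Entails (upd P) (upd Q) := by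
  intro n x _ hP k hk y hv
  obtain ⟨x', hv', hP'⟩ := hP k hk y hv
  exact ⟨x', hv', h k x' hv'.of_mul hP'⟩

theorem later_mono {P Q : IProp S} (h : Entails P Q) : Entails (later P) (later Q) :=
  fun _ x hx hP k hk => h k x hx (hP k hk)

theorem sep_mono {P P' Q Q' : IProp S} (h : Entails P P') (h' : Entails Q Q') :
    Entails (sep P Q) (sep P' Q') := by
  rintro n x hx ⟨x₁, x₂, rfl, hP, hQ⟩
  exact ⟨x₁, x₂, rfl, h n x₁ hx.of_mul hP, h' n x₂ (mul_comm x₁ x₂ ▸ hx).of_mul hQ⟩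

theorem cplF_mono (M : MarkovChain S) {Z Z' : S → Conf → IProp S}
    (hZ : ∀ m ρ, Entails (Z m ρ) (Z' m ρ)) {W W' : S × Conf → IProp S}
    (hW : ∀ p, Entails (W p) (W' p)) (p : S × Conf) :
    Entails (cplF M Z W p) (cplF M Z' W' p) := by
  rintro n x hx (⟨R, h, H⟩ | ⟨R, h, H⟩ | ⟨R, h, H⟩ | ⟨R, l, h, H⟩)
  · exact .inl ⟨R, h, fun m' ρ' hR => upd_mono (hZ m' ρ') n x hx (H m' ρ' hR)⟩
  · exact .inr <| .inl ⟨R, h, fun m' ρ' hR =>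
      later_mono (upd_mono (hZ m' ρ')) n x hx (H m' ρ' hR)⟩
  · exact .inr <| .inr <| .inl ⟨R, h, fun m' hR =>
      later_mono (upd_mono (hW _)) n x hx (H m' hR)⟩
  · exact .inr <| .inr <| .inr ⟨R, l, h, fun m' σ' hR =>
      later_mono (upd_mono (hW _)) n x hx (H m' σ' hR)⟩

theorem execCoupl_mono (M : MarkovChain S) {Z Z' : S → Conf → IProp S}
    (hZ : ∀ m ρ, Entails (Z m ρ) (Z' m ρ)) (m : S) (ρ : Conf) :
    Entails (execCoupl M m ρ Z) (execCoupl M m ρ Z') := fun n x hx h W hW =>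
  h W fun p k y hy hp => hW p k y hy (cplF_mono M hZ (fun _ _ _ _ h => h) p k y hy hp)

theorem rwpF_mono (M : MarkovChain S) (Φ : Val → IProp S) {W W' : Expr → IProp S}
    (hW : ∀ e, Entails (W e) (W' e)) (e : Expr) : Entails (rwpF M Φ W e) (rwpF M Φ W' e) := by
  rintro n x hx (h | ⟨h, H⟩)
  · exact .inl h
  · refine .inr ⟨h, fun m σ k hk y hv hP => ?_⟩
    exact upd_mono (execCoupl_mono M (fun m' ρ' => upd_mono
      (sep_mono (fun _ _ _ h => h) (sep_mono (fun _ _ _ h => h) (hW _)))) m (e, σ))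
      k (x * y) hv (H m σ k hk y hv hP)

end IProp

/-! ## The representation predicates of the lazy reals -/

namespace LazyReal

open IProp

/-- The contents `{0, 1}` of a tape as bits. -/
def bit (b : Bool) : Fin 2 := if b then 1 else 0

/-- The linked list of bits stored at `l`. -/
def isList : Loc → List Bool → IProp CmpState
  | l, [] => pointsTo l .noneV
  | l, b :: bs => ex fun l' : Loc =>
      sep (pointsTo l (.someV (.pairV (.bool b) (.loc l')))) (isList l' bs)

/-- `v` is the lazily sampled real with the bits `bs` so far: a prefix of them is stored in the
linked list, the rest is presampled on the tape. -/
def lazyReal (bs : List Bool) (v : Val) : IProp CmpState :=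
  ex fun l : Loc => ex fun α : Label => ex fun bs₁ : List Bool => ex fun bs₂ : List Bool =>
    sep (pure (v = .pairV (.loc l) (.lbl α))) <|
    sep (pure (bs = bs₁ ++ bs₂)) <|
    sep (isList l bs₁) (tapeOwn α ⟨1, bs₂.map bit⟩)

/-- At least `N` comparisons are left in the model. -/
def cmps (N : ℕ) : IProp CmpState :=
  ex fun b : Bool => ex fun M : ℕ => and (spec ((b, b), M)) (pure (N ≤ M))

end LazyReal

end

-- Two lists of bits can be compared forever only if fresh coins keep agreeing, and each round
-- without known bits ends with probability 1/2. The refinement makes this precise: in such a round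
-- the first bit `b₁` is drawn by the program alone, and the second draw is coupled with a model
-- step to `(c, d)` by setting `b₂ = b₁ xor c xor d`. For fixed `b₁` this is a fair bit, and `b₁ =
-- b₂` exactly when `c = d`. If the bits agree, the model is again in an equal pair with the same
-- counter and the program is back at `cmpList`; the coupled step is guarded by a later, so
-- induction on the step index closes the loop. If they differ, one more model step restarts it with
-- the counter decreased.
--
-- Rounds in which at least one list has a known bit consume that bit and never touch the model.
-- They are finite in number, and if one of them decides the comparison, the unused iteration is
-- dropped, because the token only bounds the counter from below.
--
-- Almost-sure termination of the programs is proved directly, not through an adequacy theorem for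
-- the weakest precondition; the comparisons of termination probabilities follow because the larger
-- side is 1. For chains and programs alike, a bound `t` on the termination probability improves to
-- `1/2 + t/2` in one round, and an optimal bound must then be at least 1
-- (`ENNReal.one_le_of_half_add_half_le`).
--
-- The two arguments about the program differ only at the second sampling of a round without known
-- bits. Everything else is carried out once, for any predicate satisfying `StepClosed`; the
-- instances are `stepClosed_rwp` and `stepClosed_termGE`. Their common part is
-- `StepClosed.cmpListSpec`, which leaves the case of two empty lists to `cmpListSpec_rwp` and
-- `cmpListSpec_termGE`.

/-! ## Expectations and support -/

namespace SubDistr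

variable {A B : Type*}

/-- The expectation of `g`. -/
noncomputable def expect (μ : SubDistr A) (g : A → ℝ≥0∞) : ℝ≥0∞ := ∑' a, μ.mass a * g a

theorem mass_ret_self (a : A) : (ret a).mass a = 1 := by simp [ret]

theorem mass_ret_ne {a b : A} (h : b ≠ a) : (ret a).mass b = 0 := by simp [ret, h]

theorem eq_of_mass_ret_pos {a b : A} (h : 0 < (ret a).mass b) : b = a := by
  by_contra hne
  simp [mass_ret_ne hne] at h

@[simp] theorem expect_ret (a : A) (g : A → ℝ≥0∞) : (ret a).expect g = g a := by
  rw [expect, tsum_eq_single a fun b hb => by rw [mass_ret_ne hb, zero_mul], mass_ret_self, one_mul]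

@[simp] theorem expect_zero (g : A → ℝ≥0∞) : (zero : SubDistr A).expect g = 0 := by
  simp [expect, zero]

theorem expect_bind (μ : SubDistr A) (f : A → SubDistr B) (g : B → ℝ≥0∞) :
    (μ.bind f).expect g = μ.expect fun a => (f a).expect g := by
  simp only [expect, bind, ← ENNReal.tsum_mul_right, ← ENNReal.tsum_mul_left]
  rw [ENNReal.tsum_comm]
  simp only [mul_assoc]

@[simp] theorem expect_map (μ : SubDistr A) (f : A → B) (g : B → ℝ≥0∞) :
    (μ.map f).expect g = μ.expect fun a => g (f a) := by
  simp [map, expect_bind]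

theorem expect_unif [Fintype A] (g : A → ℝ≥0∞) :
    (unif A).expect g = (Fintype.card A : ℝ≥0∞)⁻¹ * ∑ a, g a := by
  rw [expect, tsum_fintype, Finset.mul_sum]
  rfl

theorem expect_one (μ : SubDistr A) : (μ.expect fun _ => 1) = ∑' a, μ.mass a := by
  simp [expect]

theorem expect_unif_one [Fintype A] [Nonempty A] : ((unif A).expect fun _ => 1) = 1 := by
  rw [expect_unif]
  simp only [Finset.sum_const, Finset.card_univ, nsmul_eq_mul, mul_one]
  exact ENNReal.inv_mul_cancel (by simp) (by simp)

theorem expect_mono (μ : SubDistr A) {g g' : A → ℝ≥0∞} (h : ∀ a, 0 < μ.mass a → g a ≤ g' a) :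
    μ.expect g ≤ μ.expect g' := by
  refine ENNReal.tsum_le_tsum fun a => ?_
  rcases (zero_le (a := μ.mass a)).eq_or_lt with h0 | h0
  · simp [← h0]
  · gcongr
    exact h a h0

theorem expect_const (μ : SubDistr A) (c : ℝ≥0∞) :
    (μ.expect fun _ => c) = (μ.expect fun _ => 1) * c := by
  simp [expect, ENNReal.tsum_mul_right]

theorem exists_mass_pos_of_expect_one {μ : SubDistr A} (h : (μ.expect fun _ => 1) = 1) :
    ∃ a, 0 < μ.mass a := by
  by_contra! h0
  have : (μ.expect fun _ => 1) ≤ μ.expect fun _ => 0 :=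
    expect_mono _ fun a ha => absurd (h0 a) ha.not_ge
  rw [h] at this
  simp [expect] at this

theorem exists_of_mass_map_pos {μ : SubDistr A} {f : A → B} {b : B}
    (h : 0 < (μ.map f).mass b) : ∃ a, 0 < μ.mass a ∧ b = f a := by
  by_contra! h0
  refine h.ne' (ENNReal.tsum_eq_zero.2 fun a => ?_)
  rcases (zero_le (a := μ.mass a)).eq_or_lt with hz | hp
  · simp [← hz]
  · simp [mass_ret_ne (h0 a hp)]

theorem map_ret (a : A) (f : A → B) : (ret a).map f = ret (f a) := by
  have : ((ret a).map f).mass = (ret (f a)).mass := by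
    funext b
    exact expect_ret a fun a => (ret (f a)).mass b
  cases h : (ret a).map f
  cases h' : ret (f a)
  simp_all

@[ext] theorem ext {μ ν : SubDistr A} (h : ∀ a, μ.mass a = ν.mass a) : μ = ν := by
  cases μ; cases ν
  congr
  funext a
  exact h a

theorem map_map {C : Type*} (μ : SubDistr A) (f : A → B) (g : B → C) :
    (μ.map f).map g = μ.map fun a => g (f a) := by
  ext c
  have := expect_map μ f fun b => (ret (g b)).mass c
  exact this

theorem map_id' (μ : SubDistr A) : (μ.map fun a => a) = μ := by
  ext a
  change ∑' a', μ.mass a' * (ret a').mass a = _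
  rw [tsum_eq_single a fun b hb => by rw [mass_ret_ne hb.symm, mul_zero], mass_ret_self, mul_one]

end SubDistr

/-! ## Termination probabilities -/

theorem ENNReal.tsum_iSup_of_monotone {A : Type*} {f : ℕ → A → ℝ≥0∞}
    (hf : ∀ a, Monotone fun n => f n a) : ∑' a, ⨆ n, f n a = ⨆ n, ∑' a, f n a := by
  simp only [ENNReal.tsum_eq_iSup_sum]
  rw [iSup_comm]
  exact iSup_congr fun s => ENNReal.finsetSum_iSup_of_monotone hf

namespace MarkovChain

variable {S : Type*} (M : MarkovChain S)

theorem execN_monotone (s s' : S) : Monotone fun n => (M.execN n s).mass s' := by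
  refine monotone_nat_of_le_succ fun n => ?_
  induction n generalizing s with
  | zero =>
    by_cases h : M.final s
    · simp [execN, h]
    · simp [execN, h, SubDistr.zero]
  | succ n ih =>
    by_cases h : M.final s
    · simp [execN, h]
    · rw [execN, execN, if_neg h, if_neg h]
      exact ENNReal.tsum_le_tsum fun a => mul_le_mul_right (ih a) _

theorem execTerm_eq_iSup (s : S) : M.execTerm s = ⨆ n, ∑' s', (M.execN n s).mass s' :=
  ENNReal.tsum_iSup_of_monotone fun s' => M.execN_monotone s s'

theorem execTerm_le_one (s : S) : M.execTerm s ≤ 1 := by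
  rw [execTerm_eq_iSup]
  exact iSup_le fun n => (M.execN n s).sum_le

theorem one_le_execTerm_of_final {s : S} (h : M.final s) : 1 ≤ M.execTerm s := by
  rw [execTerm_eq_iSup]
  refine le_iSup_of_le 0 ?_
  rw [execN, if_pos h, ← SubDistr.expect_one, SubDistr.expect_ret]

/-- Holds with step counts `n` and `n + 1`, then passes to the limit by monotone convergence; at a
final state the left side vanishes. This direction suffices, since termination probabilities are
only ever bounded from below. -/
theorem expect_execTerm_le (s : S) : (M.step s).expect M.execTerm ≤ M.execTerm s := by
  by_cases h : M.final s
  · simp [SubDistr.expect, M.step_final s h]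
  · simp only [SubDistr.expect, execTerm_eq_iSup, ENNReal.mul_iSup]
    rw [ENNReal.tsum_iSup_of_monotone]
    · refine iSup_le fun n => le_iSup_of_le (n + 1) (le_of_eq ?_)
      rw [execN, if_neg h, ← SubDistr.expect_one, SubDistr.expect_bind]
      simp only [SubDistr.expect_one]
      rfl
    · exact fun a => fun i j hij => mul_le_mul_right
        (ENNReal.tsum_le_tsum fun b => M.execN_monotone a b hij) _

end MarkovChain

/-- A number that is at least the mean of itself and `1` is at least `1`. -/
theorem ENNReal.one_le_of_half_add_half_le {t : ℝ≥0∞} (h : 2⁻¹ + 2⁻¹ * t ≤ t) : 1 ≤ t := by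
  by_contra! hlt
  have h1 : 2⁻¹ * t < 2⁻¹ * 1 :=
    ENNReal.mul_lt_mul_right (by simp) (by simp) hlt
  have h2 : t = 2⁻¹ * t + 2⁻¹ * t := by
    rw [← add_mul, ENNReal.inv_two_add_inv_two, one_mul]
  have h3 : 2⁻¹ * t + 2⁻¹ * t < 2⁻¹ + 2⁻¹ * t := by
    have := ENNReal.add_lt_add_right (a := 2⁻¹ * t) (ne_top_of_lt h1) h1
    simpa using this
  exact absurd (h.trans_eq h2) h3.not_ge

/-! ## The models terminate almost surely -/

/-- Let `t` be the smaller of the two values of `F` on equal pairs. Half of the four pairs are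
unequal, so the mean is at least `1/2 + t/2`, and both values on equal pairs dominate the mean.
Keeping `F` abstract serves the base chain and each level of the iterated chain. -/
theorem one_le_of_coin_mean_le {F : Bool × Bool → ℝ≥0∞} (hne : ∀ p, p.1 ≠ p.2 → 1 ≤ F p)
    (heq : ∀ b, (SubDistr.unif (Bool × Bool)).expect F ≤ F (b, b)) (p : Bool × Bool) :
    1 ≤ F p := by
  have key : 1 ≤ min (F (true, true)) (F (false, false)) := by
    apply ENNReal.one_le_of_half_add_half_le
    refine le_trans ?_ (le_min (heq true) (heq false))
    set t := min (F (true, true)) (F (false, false))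
    -- The bracketing follows the order in which the sum over `Bool × Bool` expands, so that
    -- `gcongr` can compare term by term.
    have h4 : (2⁻¹ : ℝ≥0∞) + 2⁻¹ * t = 4⁻¹ * (t + 1 + (1 + t)) := by
      have : (2⁻¹ : ℝ≥0∞) = 4⁻¹ * 2 := by
        rw [show (4 : ℝ≥0∞) = 2 * 2 by norm_num, ENNReal.mul_inv (by simp) (by simp), mul_assoc,
          ENNReal.inv_mul_cancel (by simp) (by simp), mul_one]
      rw [this]
      ring
    have hc : (Fintype.card (Bool × Bool) : ℝ≥0∞) = 4 := by simp
    rw [SubDistr.expect_unif, h4, hc, Fintype.sum_prod_type]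
    simp only [Fintype.sum_bool]
    gcongr
    · exact min_le_left _ _
    · exact hne _ (by simp)
    · exact hne _ (by simp)
    · exact min_le_right _ _
  obtain ⟨b, b'⟩ := p
  by_cases h : b = b'
  · subst h
    cases b
    · exact key.trans (min_le_right _ _)
    · exact key.trans (min_le_left _ _)
  · exact hne _ h

theorem coinChain_execTerm (p : Bool × Bool) : coinChain.execTerm p = 1 := by
  refine (coinChain.execTerm_le_one p).antisymm (one_le_of_coin_mean_le (fun p h => ?_)
    (fun b => ?_) p)
  · exact coinChain.one_le_execTerm_of_final h
  · simpa [coinChain] using coinChain.expect_execTerm_le (b, b)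

theorem cmpChain_step_eq (b : Bool) (n : ℕ) :
    cmpChain.step ((b, b), n + 1) =
      (SubDistr.unif (Bool × Bool)).map fun p => (p, n + 1) := by
  simp [cmpChain, MarkovChain.iterate, coinChain]

theorem cmpChain_step_ne {p : Bool × Bool} (h : p.1 ≠ p.2) (n : ℕ) :
    cmpChain.step (p, n + 1) = SubDistr.ret ((true, true), n) := by
  simp [cmpChain, MarkovChain.iterate, coinChain, h]

theorem cmpChain_execTerm (q : CmpState) : cmpChain.execTerm q = 1 := by
  refine (cmpChain.execTerm_le_one q).antisymm ?_
  obtain ⟨p, n⟩ := q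
  induction n generalizing p with
  | zero => exact cmpChain.one_le_execTerm_of_final rfl
  | succ n ih =>
    refine one_le_of_coin_mean_le (F := fun p => cmpChain.execTerm (p, n + 1)) (fun p h => ?_)
      (fun b => ?_) p
    · have := cmpChain.expect_execTerm_le (p, n + 1)
      rw [cmpChain_step_ne h, SubDistr.expect_ret] at this
      exact (ih _).trans this
    · have := cmpChain.expect_execTerm_le ((b, b), n + 1)
      rwa [cmpChain_step_eq, SubDistr.expect_map] at this

/-! ## Evaluation contexts and pure evaluation -/

namespace Expr

/-- Fill a list of context items, the innermost first. -/
def fillK (K : List ECtxItem) (e : Expr) : Expr := K.foldl (fun e k => k.fill e) e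

theorem fill_ne_val (k : ECtxItem) (e : Expr) (v : Val) : k.fill e ≠ val v := by
  cases k <;> simp [ECtxItem.fill]

theorem decompItem_fill {e : Expr} (h : ∀ v, e ≠ val v) (k : ECtxItem) :
    (k.fill e).decompItem = some (k, e) := by
  have ht : e.toVal = none := by
    cases e <;> first | rfl | exact absurd rfl (h _)
  cases k <;> simp [ECtxItem.fill, decompItem, focus₂, focus, ht, toVal]

theorem fill_of_decompItem {e e' : Expr} {k : ECtxItem} (h : e.decompItem = some (k, e')) :
    k.fill e' = e ∧ ∀ v, e' ≠ val v := by
  have hv : ∀ {e : Expr} {v : Val}, e.toVal = some v → e = val v := by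
    intro e v h
    cases e <;> simp_all [toVal]
  cases e <;> simp only [decompItem, focus₂, focus, reduceCtorEq] at h <;>
    (repeat' split at h) <;>
    first
      | (exfalso; simp at h; done)
      | (simp only [Option.some.injEq, Prod.mk.injEq] at h
         obtain ⟨rfl, rfl⟩ := h
         refine ⟨?_, fun v hv' => by simp_all [toVal]⟩
         simp_all [ECtxItem.fill]
         try exact (hv (by assumption)).symm)

theorem step_of_decompItem_eq_none {e : Expr} (h : e.decompItem = none) (σ : State) :
    e.step σ = e.headStep σ := by
  rw [step]
  split
  · simp_all
  · rfl

theorem step_fill {e : Expr} (h : ∀ v, e ≠ val v) (k : ECtxItem) (σ : State) :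
    (k.fill e).step σ = (e.step σ).map fun ρ => (k.fill ρ.1, ρ.2) := by
  rw [step]
  have := decompItem_fill h k
  split
  · simp_all
  · simp_all

theorem fillK_ne_val {e : Expr} (h : ∀ v, e ≠ val v) (K : List ECtxItem) (v : Val) :
    fillK K e ≠ val v := by
  induction K generalizing e with
  | nil => exact h v
  | cons k K ih => exact ih (fill_ne_val k e)

theorem step_fillK {e : Expr} (h : ∀ v, e ≠ val v) (K : List ECtxItem) (σ : State) :
    (fillK K e).step σ = (e.step σ).map fun ρ => (fillK K ρ.1, ρ.2) := by
  induction K generalizing e with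
  | nil => exact (SubDistr.map_id' _).symm
  | cons k K ih =>
    change (fillK K (k.fill e)).step σ = _
    rw [ih (fill_ne_val k e), step_fill h, SubDistr.map_map]
    rfl

/-- Reduction of a redex that does not touch the state. -/
def pureHead : Expr → Option Expr
  | recE f x e => some (val (.recV f x e))
  | app (val (.recV f x e)) (val v) => some (substB x v (substB f (.recV f x e) e))
  | binOp op (val v) (val w) => (op.eval v w).map val
  | ite (val (.lit (.bool b))) e₁ e₂ => some (if b then e₁ else e₂)
  | pair (val v) (val w) => some (val (.pairV v w))
  | fst (val (.pairV v _)) => some (val v)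
  | snd (val (.pairV _ w)) => some (val w)
  | inl (val v) => some (val (.inlV v))
  | inr (val v) => some (val (.inrV v))
  | case (val (.inlV v)) x₁ e₁ _ _ => some (substB x₁ v e₁)
  | case (val (.inrV v)) _ _ x₂ e₂ => some (substB x₂ v e₂)
  | _ => none

theorem headStep_of_pureHead {e e' : Expr} (h : e.pureHead = some e') (σ : State) :
    e.headStep σ = .ret (e', σ) := by
  unfold pureHead at h
  split at h <;> simp only [Option.some.injEq, Option.map_eq_some_iff, reduceCtorEq] at h
  case h_3 =>
    obtain ⟨u, hu, rfl⟩ := h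
    simp only [headStep, hu]
  all_goals
    subst h
    rfl

/-- One pure step, at evaluation depth less than `fuel`. -/
def pureStep : ℕ → Expr → Option Expr
  | 0, _ => none
  | fuel + 1, e =>
    match e.decompItem with
    | some (k, e') => (pureStep fuel e').map k.fill
    | none => e.pureHead

theorem step_of_pureStep {fuel : ℕ} {e e' : Expr} (h : pureStep fuel e = some e') (σ : State) :
    e.step σ = .ret (e', σ) := by
  induction fuel generalizing e e' with
  | zero => simp [pureStep] at h
  | succ fuel ih =>
    rw [pureStep] at h
    split at h
    · next k e₀ hd =>
      obtain ⟨e₁, h₁, rfl⟩ := Option.map_eq_some_iff.1 h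
      obtain ⟨rfl, hv⟩ := fill_of_decompItem hd
      rw [step_fill hv, ih h₁, SubDistr.map_ret]
    · next hd => rw [step_of_decompItem_eq_none hd, headStep_of_pureHead h]

/-- At most `n` pure steps. -/
def pureSteps : ℕ → Expr → Expr
  | 0, e => e
  | n + 1, e =>
    match pureStep 20 e with
    | some e' => pureSteps n e'
    | none => e

end Expr

section

/-! ## Pure segments of the programs -/

namespace LazyRealCode

open Expr

/-- The call `f l₁ α₁ l₂ α₂` for `f = cmpList`. -/
def cmpListCall (l₁ : Loc) (α₁ : Label) (l₂ : Loc) (α₂ : Label) : Expr :=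
  app (app (app (app (val cmpList) (val (.loc l₁))) (val (.lbl α₁))) (val (.loc l₂)))
    (val (.lbl α₂))

def getBCall (α : Label) (l : Loc) : Expr := app (app (val getB) (val (.lbl α))) (val (.loc l))

/-- The value returned by `getB`. -/
def node (b : Bool) (l : Loc) : Val := .pairV (.bool b) (.loc l)

/-- The context of the first call of `getB` in `cmpList`. -/
def cmpCtx₁ (α₁ : Label) (l₂ : Loc) (α₂ : Label) : ECtxItem :=
  .appR <| lam (some p₁) <|
    letE (some b₁) (fst (var p₁)) <| letE (some n₁) (snd (var p₁)) <|
    letE (some p₂) (getBCall α₂ l₂) <|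
    letE (some b₂) (fst (var p₂)) <| letE (some n₂) (snd (var p₂)) <|
    letE (some c) (app (app (val cmpB) (var b₁)) (var b₂)) <|
    ite (binOp .eq (var c) (int 0))
      (app (app (app (app (val cmpList) (var n₁)) (val (.lbl α₁))) (var n₂)) (val (.lbl α₂)))
      (var c)

/-- The context of the second call of `getB` in `cmpList`. -/
def cmpCtx₂ (b : Bool) (n : Loc) (α₁ α₂ : Label) : ECtxItem :=
  .appR <| lam (some p₂) <|
    letE (some b₂) (fst (var p₂)) <| letE (some n₂) (snd (var p₂)) <|
    letE (some c) (app (app (val cmpB) (val (.bool b))) (var b₂)) <|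
    ite (binOp .eq (var c) (int 0))
      (app (app (app (app (val cmpList) (val (.loc n))) (val (.lbl α₁))) (var n₂))
        (val (.lbl α₂)))
      (var c)

/-- The context of the sampling in `getB`. -/
def flipCtx (l : Loc) : List ECtxItem :=
  [.binOpL .eq (.int 1), .appR <| lam (some b₁) <|
    letE (some n₁) (alloc noneE) <|
    letE (some v₁) (pair (var b₁) (var n₁)) <|
    seq (store (val (.loc l)) (someE (var v₁))) (var v₁)]

def getBCaseCtx (α : Label) (l : Loc) : ECtxItem :=
  .case none
    (letE (some b₁) (flipT (val (.lbl α))) <|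
     letE (some n₁) (alloc noneE) <|
     letE (some v₁) (pair (var b₁) (var n₁)) <|
     seq (store (val (.loc l)) (someE (var v₁))) (var v₁))
    (some v₁) (var v₁)

def getBAllocCtx (b : Bool) (l : Loc) : ECtxItem :=
  .appR <| lam (some n₁) <|
     letE (some v₁) (pair (val (.bool b)) (var n₁)) <|
     seq (store (val (.loc l)) (someE (var v₁))) (var v₁)

def getBStoreCtx (b : Bool) (n : Loc) : ECtxItem := .appR <| lam none (val (node b n))

/-- This segment and those below stop at an access to the heap or the tapes, at a named call, or at
a value. They hold by computation because `pureStep` recurses structurally on its fuel, whereas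
`Expr.step` is defined by well-founded recursion. -/
theorem pureSteps_getBCall (α : Label) (l : Loc) :
    pureSteps 3 (getBCall α l) = fillK [getBCaseCtx α l] (load (val (.loc l))) := by
  rfl

theorem pureSteps_getBCaseCtx_some (α : Label) (l : Loc) (v : Val) :
    pureSteps 1 (fillK [getBCaseCtx α l] (val (.someV v))) = val v := by
  rfl

theorem pureSteps_getBCaseCtx_none (α : Label) (l : Loc) :
    pureSteps 1 (fillK [getBCaseCtx α l] (val .noneV)) =
      fillK (flipCtx l) (randT (int 1) (val (.lbl α))) := by
  rfl

theorem pureSteps_flipCtx (l : Loc) (b : Bool) :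
    pureSteps 3 (fillK (flipCtx l) (int ((LazyReal.bit b).val : ℤ))) =
      fillK [getBAllocCtx b l] (alloc (val .noneV)) := by
  cases b <;> rfl

theorem pureSteps_getBAllocCtx (b : Bool) (l n : Loc) :
    pureSteps 6 (fillK [getBAllocCtx b l] (val (.loc n))) =
      fillK [getBStoreCtx b n] (store (val (.loc l)) (val (.someV (node b n)))) := by
  rfl

theorem pureSteps_getBStoreCtx (b : Bool) (n : Loc) :
    pureSteps 2 (fillK [getBStoreCtx b n] (val .unit)) = val (node b n) := by
  rfl

theorem pureSteps_cmpListCall (l₁ : Loc) (α₁ : Label) (l₂ : Loc) (α₂ : Label) :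
    pureSteps 7 (cmpListCall l₁ α₁ l₂ α₂) = fillK [cmpCtx₁ α₁ l₂ α₂] (getBCall α₁ l₁) := by
  rfl

theorem pureSteps_cmpCtx₁ (α₁ : Label) (l₂ : Loc) (α₂ : Label) (b : Bool) (n : Loc) :
    pureSteps 8 (fillK [cmpCtx₁ α₁ l₂ α₂] (val (node b n))) =
      fillK [cmpCtx₂ b n α₁ α₂] (getBCall α₂ l₂) := by
  rfl

/-- Equal bits fail both tests of `cmpB`, so both values of `b` take the same number of steps. The
count must be exact, since the recursive call would reduce further. -/
theorem pureSteps_cmpCtx₂_eq (b : Bool) (n₁ n₂ : Loc) (α₁ α₂ : Label) :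
    pureSteps 19 (fillK [cmpCtx₂ b n₁ α₁ α₂] (val (node b n₂))) =
      cmpListCall n₁ α₁ n₂ α₂ := by
  cases b <;> rfl

/-- Here 30 is only a generous upper bound: `pureSteps` stays put once a value is reached. -/
theorem pureSteps_cmpCtx₂_ne {b b' : Bool} (h : b ≠ b') (n₁ n₂ : Loc) (α₁ α₂ : Label) :
    ∃ v, pureSteps 30 (fillK [cmpCtx₂ b n₁ α₁ α₂] (val (node b' n₂))) = val v := by
  cases b <;> cases b' <;> first | exact absurd rfl h | exact ⟨_, rfl⟩

theorem pureSteps_cmpCall {l₁ l₂ : Loc} (h : l₁ ≠ l₂) (α₁ α₂ : Label) :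
    pureSteps 16 (cmpCall (.pairV (.loc l₁) (.lbl α₁)) (.pairV (.loc l₂) (.lbl α₂))) =
      ite (val (.bool false)) (int 0) (cmpListCall l₁ α₁ l₂ α₂) := by
  -- Evaluation produces the literal `l₁ == l₂` for symbolic locations; the target is brought to
  -- that form so that computation closes the goal.
  rw [← beq_eq_false_iff_ne.2 h]
  rfl

theorem pureSteps_ite_false (e₁ e₂ : Expr) :
    pureSteps 1 (ite (val (.bool false)) e₁ e₂) = e₂ := by
  rfl

theorem pureSteps_initCall :
    pureSteps 1 initCall = fillK [.pairR (alloc noneE)] (allocTape (int 1)) := by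
  rfl

/-- No reduction takes place: once the right component of the pair is a value, the same expression
is refocused on its left component. -/
theorem pureSteps_initCall_alloc (α : Label) :
    pureSteps 0 (fillK [.pairR (alloc noneE)] (val (.lbl α))) =
      fillK [.pairL (.lbl α)] (alloc (val .noneV)) := by
  rfl

theorem pureSteps_initCall_pair (α : Label) (l : Loc) :
    pureSteps 1 (fillK [.pairL (.lbl α)] (val (.loc l))) = val (.pairV (.loc l) (.lbl α)) := by
  rfl

/-- The body of the client after the creation of the two lazy reals. -/
def cmpTimesSubst (v w : Val) (N : ℕ) : Expr := subst v₂ w (subst v₁ v (cmpTimes N))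

theorem cmpTimesSubst_succ (v w : Val) (N : ℕ) :
    cmpTimesSubst v w (N + 1) = fillK [.appR (lam none (cmpTimesSubst v w N))] (cmpCall v w) := by
  rfl

theorem pureSteps_seq (v : Val) (e : Expr) :
    pureSteps 2 (fillK [.appR (lam none e)] (val v)) = e := by
  rfl

theorem client_eq (N : ℕ) :
    client N = fillK [.appR (lam (some v₁) (letE (some v₂) initCall (cmpTimes N)))] initCall := by
  rfl

theorem pureSteps_client₁ (N : ℕ) (v : Val) :
    pureSteps 2 (fillK [.appR (lam (some v₁) (letE (some v₂) initCall (cmpTimes N)))] (val v)) =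
      fillK [.appR (lam (some v₂) (subst v₁ v (cmpTimes N)))] initCall := by
  rfl

theorem pureSteps_client₂ (N : ℕ) (v w : Val) :
    pureSteps 2 (fillK [.appR (lam (some v₂) (subst v₁ v (cmpTimes N)))] (val w)) =
      cmpTimesSubst v w N := by
  rfl

end LazyRealCode

end

/-! ## Fragments compatible with a program state and a model state -/

namespace Excl

variable {A : Type*}

theorem own_ne_one (a : A) : own a ≠ 1 := fun h : own a = nil => by cases h

theorem bot_ne_one : (bot : Excl A) ≠ 1 := fun h : bot = nil => by cases h

theorem own_mul_agreesWith {a : A} {x : Excl A} {o : Option A} :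
    (own a * x).AgreesWith o ↔ o = some a ∧ x = 1 := by
  cases x
  · exact ⟨fun h => ⟨h, rfl⟩, fun h => h.1⟩
  · exact ⟨False.elim, fun h => own_ne_one _ h.2⟩
  · exact ⟨False.elim, fun h => bot_ne_one h.2⟩

theorem AgreesWith.of_mul {x y : Excl A} {o : Option A} (h : (x * y).AgreesWith o) :
    x.AgreesWith o := by
  cases x <;> cases y <;> first | exact h | trivial

theorem agreesWith_none {x : Excl A} : x.AgreesWith none ↔ x = 1 := by
  cases x
  · exact ⟨fun _ => rfl, fun _ => trivial⟩
  · exact ⟨fun h => by simp [AgreesWith] at h, fun h => absurd h (own_ne_one _)⟩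
  · exact ⟨False.elim, fun h => bot_ne_one h⟩

theorem mul_eq_one {x y : Excl A} (h : x * y = 1) : x = 1 := by
  cases x <;> cases y <;>
    first | rfl | exact absurd h (own_ne_one _) | exact absurd h bot_ne_one

end Excl

namespace Res

variable {S : Type}

/-- The fragment `x`, which has no authoritative part, agrees with `σ` and `m`. -/
structure Compat (x : Res S) (σ : State) (m : S) : Prop where
  heap : ∀ l, (x.heap l).AgreesWith (σ.heap.lookup l)
  tapes : ∀ α, (x.tapes α).AgreesWith (σ.tapes.lookup α)
  spec : x.spec.AgreesWith (some m)
  authState : x.authState = 1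
  authSpec : x.authSpec = 1

/-- The ownership of `l ↦ v`. -/
def pt (l : Loc) (v : Val) : Res S := { (1 : Res S) with heap := Pi.mulSingle l (Excl.own v) }

/-- The ownership of a tape. -/
def tp (α : Label) (t : Tape) : Res S :=
  { (1 : Res S) with tapes := Pi.mulSingle α (Excl.own t) }

/-- The ownership of the model state. -/
def sp (m : S) : Res S := { (1 : Res S) with spec := Excl.own m }

/-- The authoritative view of both states. -/
def auth (m : S) (σ : State) : Res S :=
  { (1 : Res S) with authSpec := Excl.own m } * { (1 : Res S) with authState := Excl.own σ }

/-- The authoritative views pin down the states that validity merely asserts to exist, and being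
exclusive they leave no authoritative part for `x`. Frame-preserving updates thereby become
statements about `Compat`. -/
theorem valid_mul_auth {x : Res S} {m : S} {σ : State} :
    (x * auth m σ).Valid ↔ x.Compat σ m := by
  constructor
  · rintro ⟨σ', m', h₁, h₂, h₃, h₄, h₅⟩
    obtain ⟨h₄, h₄'⟩ := Excl.own_mul_agreesWith.1
      (show (Excl.own σ * x.authState).AgreesWith (some σ') by rw [mul_comm]; exact h₄)
    obtain ⟨h₅, h₅'⟩ := Excl.own_mul_agreesWith.1
      (show (Excl.own m * x.authSpec).AgreesWith (some m') by rw [mul_comm]; exact h₅)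
    cases h₄
    cases h₅
    exact ⟨fun l => (h₁ l).of_mul, fun l => (h₂ l).of_mul, h₃.of_mul, h₄', h₅'⟩
  · rintro ⟨h₁, h₂, h₃, h₄, h₅⟩
    refine ⟨σ, m, fun l => ?_, fun α => ?_, ?_, ?_, ?_⟩
    · change (x.heap l * (1 * 1)).AgreesWith _
      simpa only [mul_one] using h₁ l
    · change (x.tapes α * (1 * 1)).AgreesWith _
      simpa only [mul_one] using h₂ α
    · change (x.spec * (1 * 1)).AgreesWith _
      simpa only [mul_one] using h₃
    · change (x.authState * Excl.own σ).AgreesWith _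
      rw [h₄, one_mul]
      rfl
    · change (x.authSpec * Excl.own m).AgreesWith _
      rw [h₅, one_mul]
      rfl

namespace Compat

variable {x y : Res S} {σ : State} {m : S}

theorem of_mul (h : (x * y).Compat σ m) : x.Compat σ m :=
  ⟨fun l => (h.heap l).of_mul, fun α => (h.tapes α).of_mul, h.spec.of_mul,
    Excl.mul_eq_one h.authState, Excl.mul_eq_one h.authSpec⟩

theorem setHeap {l : Loc} (h : x.Compat σ m) (hx : x.heap l = 1) (v : Val) :
    x.Compat (σ.setHeap l v) m := by
  refine ⟨fun l' => ?_, h.tapes, h.spec, h.authState, h.authSpec⟩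
  by_cases hl : l' = l
  · rw [hl, hx]
    trivial
  · rw [State.setHeap, Finmap.lookup_insert_of_ne _ hl]
    exact h.heap l'

theorem setTape {α : Label} (h : x.Compat σ m) (hx : x.tapes α = 1) (t : Tape) :
    x.Compat (σ.setTape α t) m := by
  refine ⟨h.heap, fun α' => ?_, h.spec, h.authState, h.authSpec⟩
  by_cases hl : α' = α
  · rw [hl, hx]
    trivial
  · rw [State.setTape, Finmap.lookup_insert_of_ne _ hl]
    exact h.tapes α'

theorem setSpec (h : x.Compat σ m) (hx : x.spec = 1) (m' : S) : x.Compat σ m' :=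
  ⟨h.heap, h.tapes, hx ▸ trivial, h.authState, h.authSpec⟩

end Compat

variable {x : Res S} {σ : State} {m : S}

theorem pt_mul_heap_self (l : Loc) (v : Val) (x : Res S) :
    (pt l v * x).heap l = Excl.own v * x.heap l := by
  change (Pi.mulSingle l (Excl.own v) : Loc → Excl Val) l * x.heap l = _
  rw [Pi.mulSingle_eq_same]

theorem pt_mul_heap_of_ne {l l' : Loc} (h : l' ≠ l) (v : Val) (x : Res S) :
    (pt l v * x).heap l' = x.heap l' := by
  change (Pi.mulSingle l (Excl.own v) : Loc → Excl Val) l' * x.heap l' = _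
  rw [Pi.mulSingle_eq_of_ne h, one_mul]

theorem tp_mul_tapes_self (α : Label) (t : Tape) (x : Res S) :
    (tp α t * x).tapes α = Excl.own t * x.tapes α := by
  change (Pi.mulSingle α (Excl.own t) : Label → Excl Tape) α * x.tapes α = _
  rw [Pi.mulSingle_eq_same]

theorem tp_mul_tapes_of_ne {α α' : Label} (h : α' ≠ α) (t : Tape) (x : Res S) :
    (tp α t * x).tapes α' = x.tapes α' := by
  change (Pi.mulSingle α (Excl.own t) : Label → Excl Tape) α' * x.tapes α' = _
  rw [Pi.mulSingle_eq_of_ne h, one_mul]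

theorem compat_pt_mul {l : Loc} {v : Val} :
    (pt l v * x).Compat σ m ↔ σ.heap.lookup l = some v ∧ x.heap l = 1 ∧ x.Compat σ m := by
  constructor
  · intro h
    have := h.heap l
    rw [pt_mul_heap_self, Excl.own_mul_agreesWith] at this
    exact ⟨this.1, this.2, (mul_comm (pt l v) x ▸ h).of_mul⟩
  · rintro ⟨h₁, h₂, h⟩
    refine ⟨fun l' => ?_, fun α => (one_mul (x.tapes α)).symm ▸ h.tapes α,
      (one_mul x.spec).symm ▸ h.spec, (one_mul x.authState).symm ▸ h.authState,
      (one_mul x.authSpec).symm ▸ h.authSpec⟩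
    by_cases hl : l' = l
    · subst hl
      rw [pt_mul_heap_self, Excl.own_mul_agreesWith]
      exact ⟨h₁, h₂⟩
    · rw [pt_mul_heap_of_ne hl]
      exact h.heap l'

theorem compat_tp_mul {α : Label} {t : Tape} :
    (tp α t * x).Compat σ m ↔ σ.tapes.lookup α = some t ∧ x.tapes α = 1 ∧ x.Compat σ m := by
  constructor
  · intro h
    have := h.tapes α
    rw [tp_mul_tapes_self, Excl.own_mul_agreesWith] at this
    exact ⟨this.1, this.2, (mul_comm (tp α t) x ▸ h).of_mul⟩
  · rintro ⟨h₁, h₂, h⟩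
    refine ⟨fun l => (one_mul (x.heap l)).symm ▸ h.heap l, fun α' => ?_,
      (one_mul x.spec).symm ▸ h.spec, (one_mul x.authState).symm ▸ h.authState,
      (one_mul x.authSpec).symm ▸ h.authSpec⟩
    by_cases hl : α' = α
    · subst hl
      rw [tp_mul_tapes_self, Excl.own_mul_agreesWith]
      exact ⟨h₁, h₂⟩
    · rw [tp_mul_tapes_of_ne hl]
      exact h.tapes α'

theorem compat_sp_mul {m' : S} :
    (sp m' * x).Compat σ m ↔ m = m' ∧ x.spec = 1 ∧ x.Compat σ m := by
  constructor
  · intro h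
    obtain ⟨h₁, h₂⟩ := Excl.own_mul_agreesWith.1
      (show (Excl.own m' * x.spec).AgreesWith (some m) from h.spec)
    exact ⟨Option.some.inj h₁, h₂, (mul_comm (sp m') x ▸ h).of_mul⟩
  · rintro ⟨rfl, h₂, h⟩
    exact ⟨fun l => (one_mul (x.heap l)).symm ▸ h.heap l,
      fun α => (one_mul (x.tapes α)).symm ▸ h.tapes α,
      Excl.own_mul_agreesWith.2 ⟨rfl, h₂⟩, (one_mul x.authState).symm ▸ h.authState,
      (one_mul x.authSpec).symm ▸ h.authSpec⟩

theorem Compat.pt_update {l : Loc} {v : Val} (h : (pt l v * x).Compat σ m) (w : Val) :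
    (pt l w * x).Compat (σ.setHeap l w) m := by
  obtain ⟨-, hx, h⟩ := compat_pt_mul.1 h
  exact compat_pt_mul.2 ⟨Finmap.lookup_insert _, hx, h.setHeap hx w⟩

/-- A fragment that agrees with the heap owns nothing at an absent location, so allocation there
cannot conflict with any frame. -/
theorem Compat.pt_alloc {l : Loc} (h : x.Compat σ m) (hl : σ.heap.lookup l = none) (v : Val) :
    (pt l v * x).Compat (σ.setHeap l v) m := by
  have hx : x.heap l = 1 := Excl.agreesWith_none.1 (hl ▸ h.heap l)
  exact compat_pt_mul.2 ⟨Finmap.lookup_insert _, hx, h.setHeap hx v⟩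

theorem Compat.tp_update {α : Label} {t : Tape} (h : (tp α t * x).Compat σ m) (u : Tape) :
    (tp α u * x).Compat (σ.setTape α u) m := by
  obtain ⟨-, hx, h⟩ := compat_tp_mul.1 h
  exact compat_tp_mul.2 ⟨Finmap.lookup_insert _, hx, h.setTape hx u⟩

theorem Compat.tp_alloc {α : Label} (h : x.Compat σ m) (hl : σ.tapes.lookup α = none)
    (t : Tape) : (tp α t * x).Compat (σ.setTape α t) m := by
  have hx : x.tapes α = 1 := Excl.agreesWith_none.1 (hl ▸ h.tapes α)
  exact compat_tp_mul.2 ⟨Finmap.lookup_insert _, hx, h.setTape hx t⟩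

theorem Compat.sp_update {m' : S} (h : (sp m * x).Compat σ m') (m'' : S) :
    (sp m'' * x).Compat σ m'' := by
  obtain ⟨-, hx, h⟩ := compat_sp_mul.1 h
  exact compat_sp_mul.2 ⟨rfl, hx, h.setSpec hx m''⟩

theorem compat_ofState (σ : State) (m : S) : (ofState σ : Res S).Compat σ m := by
  have key : ∀ {A : Type} (o : Option A), (Excl.ofOption o).AgreesWith o := by
    rintro A (_ | a)
    · trivial
    · rfl
  exact ⟨fun l => key _, fun α => key _, trivial, rfl, rfl⟩

end Res

namespace State

theorem lookup_freshLoc (σ : State) : σ.heap.lookup σ.freshLoc = none := by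
  rw [Finmap.lookup_eq_none, ← Finmap.mem_keys]
  intro h
  exact absurd (Finset.le_sup (f := id) h) (Nat.lt_succ_self _).not_ge

theorem lookup_freshLabel (σ : State) : σ.tapes.lookup σ.freshLabel = none := by
  rw [Finmap.lookup_eq_none, ← Finmap.mem_keys]
  intro h
  exact absurd (Finset.le_sup (f := id) h) (Nat.lt_succ_self _).not_ge

end State

section

open Expr in
theorem Expr.step_randT_nil {N : ℕ} {α : Label} {σ : State}
    (hl : σ.tapes.lookup α = some ⟨N, []⟩) :
    (randT (int N) (val (.lbl α))).step σ = Expr.sample N σ := by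
  rw [step_of_decompItem_eq_none rfl]
  simp [headStep, Expr.int, Val.int, Val.lbl, hl]

/-! ## Predicates closed under program steps -/

open Res

theorem IProp.mono_index {S : Type} (P : IProp S) {n k : ℕ} {x : Res S} (hk : k ≤ n)
    (h : P.holds n x) : P.holds k x := by
  simpa using P.mono 1 hk h

/-- `J` holds of a redex if it holds after each step, up to a frame-preserving update. -/
def StepClosed {S : Type} (J : Expr → IProp S) : Prop :=
  ∀ (e : Expr) (n : ℕ) (x : Res S), (∀ v, e ≠ .val v) →
    (∀ k ≤ n, ∀ σ m f, (x * f).Compat σ m →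
      ((e.step σ).expect fun _ => 1) = 1 ∧
      ∀ e' σ', 0 < (e.step σ).mass (e', σ') →
        ∃ x', (x' * f).Compat σ' m ∧ (J e').holds k x') →
    (J e).holds n x

namespace StepClosed

open Expr

variable {S : Type} {J : Expr → IProp S} (hJ : StepClosed J) {n : ℕ} {K : List ECtxItem}
include hJ

/-- A step under a context is the image of the step of the redex. With `K` carried along, the rules
below are in continuation-passing form, and no separate bind rule is needed. -/
theorem fillK_step {e : Expr} {x : Res S} (he : ∀ v, e ≠ val v)
    (h : ∀ k ≤ n, ∀ σ m f, (x * f).Compat σ m →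
      ((e.step σ).expect fun _ => 1) = 1 ∧
      ∀ e' σ', 0 < (e.step σ).mass (e', σ') →
        ∃ x', (x' * f).Compat σ' m ∧ (J (fillK K e')).holds k x') :
    (J (fillK K e)).holds n x := by
  refine hJ _ n x (fillK_ne_val he K) fun k hk σ m f hc => ?_
  obtain ⟨h₁, h₂⟩ := h k hk σ m f hc
  rw [step_fillK he, SubDistr.expect_map]
  refine ⟨h₁, fun e' σ' hp => ?_⟩
  obtain ⟨⟨e₀, σ₀⟩, hp₀, heq⟩ := SubDistr.exists_of_mass_map_pos hp
  cases heq
  exact h₂ _ _ hp₀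

theorem fillK_det {e : Expr} {x : Res S} (he : ∀ v, e ≠ val v)
    (h : ∀ k ≤ n, ∀ σ m f, (x * f).Compat σ m →
      ∃ e' σ' x', e.step σ = .ret (e', σ') ∧ (x' * f).Compat σ' m ∧
        (J (fillK K e')).holds k x') :
    (J (fillK K e)).holds n x := by
  refine hJ.fillK_step he fun k hk σ m f hc => ?_
  obtain ⟨e', σ', x', hs, hc', hJ'⟩ := h k hk σ m f hc
  rw [hs, SubDistr.expect_ret]
  refine ⟨rfl, fun e₁ σ₁ hp => ?_⟩
  cases SubDistr.eq_of_mass_ret_pos hp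
  exact ⟨x', hc', hJ'⟩

theorem pure_step {e e' : Expr} {x : Res S} (hp : pureStep 20 e = some e')
    (h : (∃ σ m, x.Compat σ m) → (J (fillK K e')).holds n x) : (J (fillK K e)).holds n x := by
  have he : ∀ v, e ≠ val v := by
    rintro v rfl
    simp [pureStep, decompItem, pureHead] at hp
  exact hJ.fillK_det he fun k hk σ m f hc => ⟨e', σ, x, step_of_pureStep hp σ, hc,
    (J _).mono_index hk (h ⟨σ, m, hc.of_mul⟩)⟩

theorem pure_steps {e : Expr} {x : Res S} (i : ℕ)
    (h : (J (fillK K (pureSteps i e))).holds n x) : (J (fillK K e)).holds n x := by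
  induction i generalizing e with
  | zero => exact h
  | succ i ih =>
    cases hp : pureStep 20 e with
    | none => simpa only [pureSteps, hp] using h
    | some e' =>
      simp only [pureSteps, hp] at h
      exact hJ.pure_step hp fun _ => ih h

theorem pure (K₁ K₂ : List ECtxItem) {e e' : Expr} {x : Res S} {i : ℕ}
    (he : pureSteps i (fillK K₁ e) = fillK K₂ e') (h : (J (fillK (K₂ ++ K) e')).holds n x) :
    (J (fillK (K₁ ++ K) e)).holds n x := by
  have := hJ.pure_steps (K := K) (e := fillK K₁ e) (x := x) (n := n) i (by
    rw [he]
    simpa only [fillK, List.foldl_append] using h)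
  simpa only [fillK, List.foldl_append] using this

/-- The first pure step serves to learn that the resource is compatible with some state; facts about
disjoint ownership can then decide the steps that follow. -/
theorem pure_compat {e : Expr} {x : Res S} (i : ℕ) (hs : (pureStep 20 e).isSome)
    (h : (∃ σ m, x.Compat σ m) → (J (fillK K (pureSteps (i + 1) e))).holds n x) :
    (J (fillK K e)).holds n x := by
  obtain ⟨e', hp⟩ := Option.isSome_iff_exists.1 hs
  refine hJ.pure_step hp fun hc => hJ.pure_steps i ?_
  simpa only [pureSteps, hp] using h hc

theorem load {l : Loc} {v : Val} {x : Res S} (h : (J (fillK K (val v))).holds n (pt l v * x)) :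
    (J (fillK K (load (val (.loc l))))).holds n (pt l v * x) := by
  refine hJ.fillK_det (by simp) fun k hk σ m f hc => ?_
  obtain ⟨hl, -⟩ := compat_pt_mul.1 hc.of_mul
  refine ⟨_, σ, _, ?_, hc, (J _).mono_index hk h⟩
  rw [step_of_decompItem_eq_none rfl]
  simp [headStep, Val.loc, hl]

theorem store {l : Loc} {v w : Val} {x : Res S}
    (h : (J (fillK K (val .unit))).holds n (pt l w * x)) :
    (J (fillK K (store (val (.loc l)) (val w)))).holds n (pt l v * x) := by
  refine hJ.fillK_det (by simp) fun k hk σ m f hc => ?_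
  obtain ⟨hl, -⟩ := compat_pt_mul.1 hc.of_mul
  refine ⟨_, σ.setHeap l w, _, ?_, ?_, (J _).mono_index hk h⟩
  · rw [step_of_decompItem_eq_none rfl]
    simp [headStep, Val.loc, hl]
  · rw [mul_assoc] at hc ⊢
    exact hc.pt_update w

theorem alloc {v : Val} {x : Res S}
    (h : ∀ l : Loc, (J (fillK K (val (.loc l)))).holds n (pt l v * x)) :
    (J (fillK K (alloc (val v)))).holds n x := by
  refine hJ.fillK_det (by simp) fun k hk σ m f hc =>
    ⟨_, _, _, step_of_decompItem_eq_none rfl σ, ?_, (J _).mono_index hk (h σ.freshLoc)⟩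
  rw [mul_assoc]
  exact hc.pt_alloc σ.lookup_freshLoc v

theorem allocTape {N : ℕ} {x : Res S}
    (h : ∀ α : Label, (J (fillK K (val (.lbl α)))).holds n (tp α ⟨N, []⟩ * x)) :
    (J (fillK K (allocTape (int N)))).holds n x := by
  refine hJ.fillK_det (by simp) fun k hk σ m f hc =>
    ⟨_, _, _, step_of_decompItem_eq_none rfl σ, ?_, (J _).mono_index hk (h σ.freshLabel)⟩
  rw [mul_assoc]
  exact hc.tp_alloc σ.lookup_freshLabel _

theorem randT_cons {N : ℕ} {i : Fin (N + 1)} {is : List (Fin (N + 1))} {α : Label} {x : Res S}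
    (h : (J (fillK K (int (i.val : ℤ)))).holds n (tp α ⟨N, is⟩ * x)) :
    (J (fillK K (randT (int N) (val (.lbl α))))).holds n (tp α ⟨N, i :: is⟩ * x) := by
  refine hJ.fillK_det (by simp) fun k hk σ m f hc => ?_
  obtain ⟨hl, -⟩ := compat_tp_mul.1 hc.of_mul
  refine ⟨_, σ.setTape α ⟨N, is⟩, _, ?_, ?_, (J _).mono_index hk h⟩
  · rw [step_of_decompItem_eq_none rfl]
    simp [headStep, Expr.int, Val.int, Val.lbl, hl]
  · rw [mul_assoc] at hc ⊢
    exact hc.tp_update _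

theorem randT_nil {N : ℕ} {α : Label} {x : Res S}
    (h : ∀ i : Fin (N + 1), (J (fillK K (int (i.val : ℤ)))).holds n (tp α ⟨N, []⟩ * x)) :
    (J (fillK K (randT (int N) (val (.lbl α))))).holds n (tp α ⟨N, []⟩ * x) := by
  refine hJ.fillK_step (by simp) fun k hk σ m f hc => ?_
  obtain ⟨hl, -⟩ := compat_tp_mul.1 hc.of_mul
  rw [step_randT_nil hl, sample, SubDistr.expect_map]
  refine ⟨SubDistr.expect_unif_one, fun e' σ' hp => ?_⟩
  obtain ⟨i, -, heq⟩ := SubDistr.exists_of_mass_map_pos hp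
  cases heq
  exact ⟨_, hc, (J _).mono_index hk (h i)⟩

end StepClosed

end

section

/-! ## The lazy real library, for every predicate closed under program steps -/

open Res LazyRealCode

namespace LazyReal

/-- `x` is the ownership of the linked list `bs` at a location. -/
inductive ListRes : Loc → List Bool → Res CmpState → Prop
  | nil (l : Loc) : ListRes l [] (pt l .noneV)
  | cons (l : Loc) (b : Bool) (bs : List Bool) (l' : Loc) (x : Res CmpState) :
      ListRes l' bs x → ListRes l (b :: bs) (pt l (.someV (node b l')) * x)

/-- `x` is the ownership of a lazy real at `l` and `α` whose bits from there on are `bs`. -/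
def LazyRes (l : Loc) (α : Label) (bs : List Bool) (x : Res CmpState) : Prop :=
  ∃ bs₁ bs₂ y, bs = bs₁ ++ bs₂ ∧ ListRes l bs₁ y ∧ x = y * tp α ⟨1, bs₂.map bit⟩

theorem LazyRes.cons {l l' : Loc} {α : Label} {bs : List Bool} {x : Res CmpState}
    (h : LazyRes l' α bs x) (b : Bool) :
    LazyRes l α (b :: bs) (pt l (.someV (node b l')) * x) := by
  obtain ⟨bs₁, bs₂, y, rfl, hy, rfl⟩ := h
  exact ⟨b :: bs₁, bs₂, _, rfl, .cons l b bs₁ l' y hy, (mul_assoc _ _ _).symm⟩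

theorem LazyRes.nil (l : Loc) (α : Label) :
    LazyRes l α [] (pt l .noneV * tp α ⟨1, []⟩) :=
  ⟨[], [], _, rfl, .nil l, rfl⟩

theorem LazyRes.eq_of_nil {l : Loc} {α : Label} {x : Res CmpState} (h : LazyRes l α [] x) :
    x = pt l .noneV * tp α ⟨1, []⟩ := by
  obtain ⟨bs₁, bs₂, y, h, hy, rfl⟩ := h
  obtain ⟨rfl, rfl⟩ := List.append_eq_nil_iff.1 h.symm
  cases hy
  rfl

theorem LazyRes.exists_pt {l : Loc} {α : Label} {bs : List Bool} {x : Res CmpState}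
    (h : LazyRes l α bs x) : ∃ v x', x = pt l v * x' := by
  obtain ⟨bs₁, bs₂, y, -, hy, rfl⟩ := h
  cases hy
  · exact ⟨_, _, rfl⟩
  · exact ⟨_, _, mul_assoc _ _ _⟩

/-- Each lazy real owns its head cell exclusively, even when no bit is stored yet, so a common head
would be owned twice. -/
theorem LazyRes.ne_of_compat {l₁ l₂ : Loc} {α₁ α₂ : Label} {bs₁ bs₂ : List Bool}
    {x₁ x₂ y : Res CmpState} {σ : State} {m : CmpState} (h₁ : LazyRes l₁ α₁ bs₁ x₁)
    (h₂ : LazyRes l₂ α₂ bs₂ x₂) (h : (x₁ * x₂ * y).Compat σ m) : l₁ ≠ l₂ := by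
  rintro rfl
  obtain ⟨v, x, rfl⟩ := h₁.exists_pt
  obtain ⟨w, x', rfl⟩ := h₂.exists_pt
  rw [show pt l₁ v * x * (pt l₁ w * x') * y = pt l₁ v * (pt l₁ w * (x * x' * y)) by
    ac_rfl] at h
  have := (compat_pt_mul.1 h).2.1
  rw [pt_mul_heap_self] at this
  exact Excl.own_ne_one _ (Excl.mul_eq_one this)

theorem exists_bit (i : Fin 2) : ∃ b, bit b = i := by
  fin_cases i
  · exact ⟨false, rfl⟩
  · exact ⟨true, rfl⟩

end LazyReal

-- Symbolic execution of `init` and `getB`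

namespace StepClosed

open Expr LazyReal

variable {J : Expr → IProp CmpState} (hJ : StepClosed J) {n : ℕ} {K : List ECtxItem}
  {y : Res CmpState}
include hJ

theorem initCall
    (h : ∀ l α x, LazyRes l α [] x →
      (J (fillK K (val (.pairV (.loc l) (.lbl α))))).holds n (x * y)) :
    (J (fillK K initCall)).holds n y := by
  refine hJ.pure [] _ pureSteps_initCall (hJ.allocTape (N := 1) fun α => ?_)
  refine hJ.pure _ _ (pureSteps_initCall_alloc α) (hJ.alloc fun l => ?_)
  refine hJ.pure _ [] (pureSteps_initCall_pair α l) ?_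
  rw [← mul_assoc]
  exact h l α _ (.nil l α)

/-- A call of `getB` at the end of the list, up to the sampling. -/
theorem getBCall_sample {l : Loc} {α : Label}
    (h : (J (fillK (flipCtx l ++ K) (randT (int 1) (val (.lbl α))))).holds n
      (pt l .noneV * y)) :
    (J (fillK K (getBCall α l))).holds n (pt l .noneV * y) :=
  hJ.pure [] _ (pureSteps_getBCall α l) <| hJ.load <|
    hJ.pure _ _ (pureSteps_getBCaseCtx_none α l) h

/-- A call of `getB` at the end of the list, after the sampling. -/
theorem getBCall_sampled {l : Loc} {b : Bool}
    (h : ∀ l', (J (fillK K (val (node b l')))).holds n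
      (pt l (.someV (node b l')) * (pt l' .noneV * y))) :
    (J (fillK (flipCtx l ++ K) (int ((bit b).val : ℤ)))).holds n (pt l .noneV * y) := by
  refine hJ.pure _ _ (pureSteps_flipCtx l b) (hJ.alloc fun l' => ?_)
  refine hJ.pure _ _ (pureSteps_getBAllocCtx b l l') ?_
  rw [mul_left_comm]
  exact hJ.store (hJ.pure _ [] (pureSteps_getBStoreCtx b l') (h l'))

/-- The next known bit is either stored in the list and just read, or it heads the tape and moves
into a new list cell. Either way the call is deterministic in the bit it returns. -/
theorem getBCall_cons {l : Loc} {α : Label} {b : Bool} {bs : List Bool} {x : Res CmpState}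
    (hx : LazyRes l α (b :: bs) x)
    (h : ∀ l' x', LazyRes l' α bs x' → (J (fillK K (val (node b l')))).holds n
      (pt l (.someV (node b l')) * x' * y)) :
    (J (fillK K (getBCall α l))).holds n (x * y) := by
  obtain ⟨bs₁, bs₂, z, hbs, hz, rfl⟩ := hx
  cases hz with
  | nil =>
    obtain rfl : b :: bs = bs₂ := hbs
    rw [mul_assoc]
    refine hJ.getBCall_sample ?_
    rw [mul_left_comm]
    refine hJ.randT_cons (N := 1) ?_
    rw [mul_left_comm]
    refine hJ.getBCall_sampled fun l' => ?_
    rw [← mul_assoc (pt l' _), ← mul_assoc]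
    exact h l' _ ⟨[], bs, _, rfl, .nil l', rfl⟩
  | cons _ b' bs₁ l' z hz =>
    obtain ⟨rfl, rfl⟩ := List.cons.inj hbs
    rw [mul_assoc, mul_assoc]
    refine hJ.pure [] _ (pureSteps_getBCall α l) (hJ.load ?_)
    refine hJ.pure _ [] (pureSteps_getBCaseCtx_some α l _) ?_
    rw [← mul_assoc z, ← mul_assoc]
    exact h l' _ ⟨bs₁, bs₂, _, rfl, hz, rfl⟩

theorem getBCall_nil {l : Loc} {α : Label} {x : Res CmpState} (hx : LazyRes l α [] x)
    (h : ∀ b l' x', LazyRes l' α [] x' → (J (fillK K (val (node b l')))).holds n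
      (pt l (.someV (node b l')) * x' * y)) :
    (J (fillK K (getBCall α l))).holds n (x * y) := by
  rw [hx.eq_of_nil, mul_assoc]
  refine hJ.getBCall_sample ?_
  rw [mul_left_comm]
  refine hJ.randT_nil (N := 1) fun i => ?_
  obtain ⟨b, rfl⟩ := exists_bit i
  rw [mul_left_comm]
  refine hJ.getBCall_sampled fun l' => ?_
  rw [← mul_assoc (pt l' _), ← mul_assoc]
  exact h b l' _ (.nil l' α)

end StepClosed

/-- The comparison of the lists with the remaining bits `bs₁`, `bs₂` under `K` turns the token `A`
into the token `B`; what follows it needs `P`. -/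
def CmpListSpec (J : Expr → IProp CmpState) (P : Val → IProp CmpState) (n : ℕ) (K : List ECtxItem) (α₁ α₂ : Label)
    (A B : Res CmpState → Prop) (bs₁ bs₂ : List Bool) : Prop :=
  ∀ (l₁ l₂ : Loc) (x₁ x₂ a y : Res CmpState), LazyReal.LazyRes l₁ α₁ bs₁ x₁ →
    LazyReal.LazyRes l₂ α₂ bs₂ x₂ → A a →
    (∀ v bs₁' bs₂' x₁' x₂' b, LazyReal.LazyRes l₁ α₁ (bs₁ ++ bs₁') x₁' →
      LazyReal.LazyRes l₂ α₂ (bs₂ ++ bs₂') x₂' → B b →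
      (P v).holds n (x₁' * x₂' * (b * y))) →
    (J (Expr.fillK K (cmpListCall l₁ α₁ l₂ α₂))).holds n (x₁ * x₂ * (a * y))

-- Rounds of the comparison and the client program

namespace StepClosed

open Expr LazyReal

variable {J : Expr → IProp CmpState} (hJ : StepClosed J) {n : ℕ} {K : List ECtxItem}
  {α₁ α₂ : Label} {A B : Res CmpState → Prop} {P : Val → IProp CmpState}
include hJ

theorem cmpList_first {l₁ l₂ : Loc} {x : Res CmpState}
    (h : (J (fillK (cmpCtx₁ α₁ l₂ α₂ :: K) (getBCall α₁ l₁))).holds n x) :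
    (J (fillK K (cmpListCall l₁ α₁ l₂ α₂))).holds n x :=
  hJ.pure [] [_] (pureSteps_cmpListCall l₁ α₁ l₂ α₂) h

theorem cmpList_second {b : Bool} {l l₂ : Loc} {x : Res CmpState}
    (h : (J (fillK (cmpCtx₂ b l α₁ α₂ :: K) (getBCall α₂ l₂))).holds n x) :
    (J (fillK (cmpCtx₁ α₁ l₂ α₂ :: K) (val (node b l)))).holds n x :=
  hJ.pure [_] [_] (pureSteps_cmpCtx₁ α₁ l₂ α₂ b l) h

/-- The end of a round of `cmpList`. -/
theorem cmpList_compare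
    (hP : ∀ v x, (P v).holds n x → (J (fillK K (val v))).holds n x)
    {l₁ l₂ l₁' l₂' : Loc} {b₁ b₂ : Bool} {bs₁ bs₂ : List Bool}
    {x₁ x₂ a y : Res CmpState} (hx₁ : LazyRes l₁' α₁ bs₁ x₁) (hx₂ : LazyRes l₂' α₂ bs₂ x₂)
    (heq : b₁ = b₂ → A a ∧ CmpListSpec J P n K α₁ α₂ A B bs₁ bs₂) (hne : b₁ ≠ b₂ → B a)
    (h : ∀ v bs₁' bs₂' x₁' x₂' b, LazyRes l₁ α₁ (b₁ :: bs₁ ++ bs₁') x₁' →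
      LazyRes l₂ α₂ (b₂ :: bs₂ ++ bs₂') x₂' → B b →
      (P v).holds n (x₁' * x₂' * (b * y))) :
    (J (fillK (cmpCtx₂ b₁ l₁' α₁ α₂ :: K) (val (node b₂ l₂')))).holds n
      (pt l₁ (.someV (node b₁ l₁')) * x₁ * (pt l₂ (.someV (node b₂ l₂')) * x₂) * (a * y)) := by
  by_cases hb : b₁ = b₂
  · obtain ⟨ha, hs⟩ := heq hb
    subst hb
    refine hJ.pure [_] [] (pureSteps_cmpCtx₂_eq b₁ l₁' l₂' α₁ α₂) ?_
    -- The two head cells join the frame during the recursive call on the tails, and are put back in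
    -- front of the resulting lists afterwards.
    rw [show ∀ p q : Res CmpState, p * x₁ * (q * x₂) * (a * y) = x₁ * x₂ * (a * (p * q * y)) from
      fun p q => by ac_rfl]
    refine hs l₁' l₂' x₁ x₂ a
      (pt l₁ (.someV (node b₁ l₁')) * pt l₂ (.someV (node b₁ l₂')) * y) hx₁ hx₂ ha
      fun v bs₁' bs₂' x₁' x₂' c h₁ h₂ hc => by
        rw [show ∀ p q : Res CmpState,
          x₁' * x₂' * (c * (p * q * y)) = p * x₁' * (q * x₂') * (c * y) from
          fun p q => by ac_rfl]
        exact h v bs₁' bs₂' _ _ c (h₁.cons b₁) (h₂.cons b₁) hc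
  · obtain ⟨v, hv⟩ := pureSteps_cmpCtx₂_ne hb l₁' l₂' α₁ α₂
    refine hJ.pure [_] [] hv (hP v _ (h v [] [] _ _ a ?_ ?_ (hne hb)))
    · rw [List.append_nil]
      exact hx₁.cons b₁
    · rw [List.append_nil]
      exact hx₂.cons b₂

/-- A comparison reduces to the comparison of two lists without known bits. -/
theorem cmpListSpec
    (hP : ∀ v x, (P v).holds n x → (J (fillK K (val v))).holds n x)
    (hAB : ∀ a, A a → B a) (h₀ : CmpListSpec J P n K α₁ α₂ A B [] [])
    (bs₁ bs₂ : List Bool) : CmpListSpec J P n K α₁ α₂ A B bs₁ bs₂ := by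
  have e₁ : ∀ x₁ x₂ z : Res CmpState, x₁ * x₂ * z = x₁ * (x₂ * z) := mul_assoc
  have e₂ : ∀ x₁ x₂ z : Res CmpState, x₁ * (x₂ * z) = x₂ * (x₁ * z) := mul_left_comm
  have e₃ : ∀ x₁ x₂ z : Res CmpState, x₂ * (x₁ * z) = x₁ * x₂ * z := fun x₁ x₂ z => by ac_rfl
  induction bs₁ generalizing bs₂ with
  | nil =>
    induction bs₂ with
    | nil => exact h₀
    | cons b₂ bs₂ ih =>
      intro l₁ l₂ x₁ x₂ a y hx₁ hx₂ ha h
      rw [e₁]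
      -- Only the first bit is unknown, and the program draws it alone. The known list shrinks
      -- whatever its value, so the token stays `A` for the recursion and is weakened to `B` if the
      -- bits differ.
      refine hJ.cmpList_first (hJ.getBCall_nil hx₁ fun b₁ l₁' x₁' hx₁' => hJ.cmpList_second ?_)
      rw [e₂]
      refine hJ.getBCall_cons hx₂ fun l₂' x₂' hx₂' => ?_
      rw [e₃]
      exact hJ.cmpList_compare hP hx₁' hx₂' (fun _ => ⟨ha, ih⟩) (fun _ => hAB a ha)
        fun v bs₁' bs₂' => h v (b₁ :: bs₁') bs₂'
  | cons b₁ bs₁ ih =>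
    intro l₁ l₂ x₁ x₂ a y hx₁ hx₂ ha h
    rw [e₁]
    refine hJ.cmpList_first (hJ.getBCall_cons hx₁ fun l₁' x₁' hx₁' => hJ.cmpList_second ?_)
    rw [e₂]
    cases bs₂ with
    | nil =>
      refine hJ.getBCall_nil hx₂ fun b₂ l₂' x₂' hx₂' => ?_
      rw [e₃]
      exact hJ.cmpList_compare hP hx₁' hx₂' (fun _ => ⟨ha, ih []⟩) (fun _ => hAB a ha)
        fun v bs₁' bs₂' => h v bs₁' (b₂ :: bs₂')
    | cons b₂ bs₂ =>
      refine hJ.getBCall_cons hx₂ fun l₂' x₂' hx₂' => ?_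
      rw [e₃]
      exact hJ.cmpList_compare hP hx₁' hx₂' (fun _ => ⟨ha, ih bs₂⟩) (fun _ => hAB a ha) h

/-- A round of `cmpList` without known bits, up to the second sampling. -/
theorem cmpList_nil_nil {l₁ l₂ : Loc} {x₁ x₂ y : Res CmpState}
    (hx₁ : LazyRes l₁ α₁ [] x₁) (hx₂ : LazyRes l₂ α₂ [] x₂)
    (h : ∀ b₁ l₁' x₁', LazyRes l₁' α₁ [] x₁' →
      (J (fillK (flipCtx l₂ ++ cmpCtx₂ b₁ l₁' α₁ α₂ :: K) (randT (int 1) (val (.lbl α₂))))).holds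
        n (pt l₁ (.someV (node b₁ l₁')) * x₁' * x₂ * y)) :
    (J (fillK K (cmpListCall l₁ α₁ l₂ α₂))).holds n (x₁ * x₂ * y) := by
  rw [mul_assoc]
  -- The first bit may be arbitrary: the randomness that matters is whether the second one equals
  -- it.
  refine hJ.cmpList_first (hJ.getBCall_nil hx₁ fun b₁ l₁' x₁' hx₁' => hJ.cmpList_second ?_)
  obtain rfl := hx₂.eq_of_nil
  rw [show ∀ p q : Res CmpState, p * x₁' * (q * tp α₂ ⟨1, []⟩ * y) =
    q * (p * x₁' * (tp α₂ ⟨1, []⟩ * y)) from fun p q => by ac_rfl]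
  refine hJ.getBCall_sample ?_
  have := h b₁ l₁' x₁' hx₁'
  rwa [show ∀ p q : Res CmpState, p * x₁' * (q * tp α₂ ⟨1, []⟩) * y =
    q * (p * x₁' * (tp α₂ ⟨1, []⟩ * y)) from fun p q => by ac_rfl] at this

/-- A round of `cmpList` without known bits, after the second sampling. -/
theorem cmpList_sampled
    (hP : ∀ v x, (P v).holds n x → (J (fillK K (val v))).holds n x)
    {l₁ l₂ l₁' : Loc} {b₁ b₂ : Bool} {x₁ x₂ a y : Res CmpState}
    (hx₁ : LazyRes l₁' α₁ [] x₁) (hx₂ : LazyRes l₂ α₂ [] x₂)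
    (heq : b₁ = b₂ → A a ∧ CmpListSpec J P n K α₁ α₂ A B [] []) (hne : b₁ ≠ b₂ → B a)
    (h : ∀ v bs₁' bs₂' x₁' x₂' b, LazyRes l₁ α₁ bs₁' x₁' → LazyRes l₂ α₂ bs₂' x₂' → B b →
      (P v).holds n (x₁' * x₂' * (b * y))) :
    (J (fillK (flipCtx l₂ ++ cmpCtx₂ b₁ l₁' α₁ α₂ :: K) (int ((bit b₂).val : ℤ)))).holds n
      (pt l₁ (.someV (node b₁ l₁')) * x₁ * x₂ * (a * y)) := by
  obtain rfl := hx₂.eq_of_nil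
  rw [show ∀ p q : Res CmpState, p * x₁ * (q * tp α₂ ⟨1, []⟩) * (a * y) =
    q * (p * x₁ * tp α₂ ⟨1, []⟩ * (a * y)) from fun p q => by ac_rfl]
  refine hJ.getBCall_sampled fun l₂' => ?_
  rw [show ∀ p q r : Res CmpState, r * (q * (p * x₁ * tp α₂ ⟨1, []⟩ * (a * y))) =
    p * x₁ * (r * (q * tp α₂ ⟨1, []⟩)) * (a * y) from fun p q r => by ac_rfl]
  exact hJ.cmpList_compare hP hx₁ (.nil l₂' α₂) heq hne fun v bs₁' bs₂' => h v _ _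

/-- The specification of `cmp`. -/
theorem cmpCall (hAB : ∀ a, A a → B a)
    (h₀ : CmpListSpec J (fun v => J (fillK K (val v))) n K α₁ α₂ A B [] [])
    {l₁ l₂ : Loc} {bs₁ bs₂ : List Bool} {x₁ x₂ a y : Res CmpState}
    (hx₁ : LazyRes l₁ α₁ bs₁ x₁) (hx₂ : LazyRes l₂ α₂ bs₂ x₂) (ha : A a)
    (h : ∀ v bs₁' bs₂' x₁' x₂' b, LazyRes l₁ α₁ (bs₁ ++ bs₁') x₁' →
      LazyRes l₂ α₂ (bs₂ ++ bs₂') x₂' → B b →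
      (J (fillK K (val v))).holds n (x₁' * x₂' * (b * y))) :
    (J (fillK K (cmpCall (.pairV (.loc l₁) (.lbl α₁)) (.pairV (.loc l₂) (.lbl α₂))))).holds n
      (x₁ * x₂ * (a * y)) := by
  -- Compatibility gives distinct head locations, which decides the pointer test reached after 15 +
  -- 1 steps.
  refine hJ.pure_compat 15 rfl fun ⟨σ, m, hc⟩ => ?_
  rw [pureSteps_cmpCall (hx₁.ne_of_compat hx₂ hc)]
  refine hJ.pure_steps 1 ?_
  rw [pureSteps_ite_false]
  exact hJ.cmpListSpec (fun _ _ h => h) hAB h₀ bs₁ bs₂ l₁ l₂ x₁ x₂ a y hx₁ hx₂ ha h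

/-- The client with `N` comparisons, which turn the token `A N` into `A 0` one by one. -/
theorem client {A : ℕ → Res CmpState → Prop} (hA : ∀ N a, A (N + 1) a → A N a)
    (h₀ : ∀ N K α₁ α₂,
      CmpListSpec J (fun v => J (fillK K (val v))) n K α₁ α₂ (A (N + 1)) (A N) [] [])
    (hval : ∀ v x, (J (val v)).holds n x) {N : ℕ} {a y : Res CmpState} (ha : A N a) :
    (J (client N)).holds n (a * y) := by
  rw [client_eq]
  refine hJ.initCall (K := [_]) fun l₁ α₁ x₁ hx₁ => ?_
  refine hJ.pure (K := []) [_] [_] (pureSteps_client₁ N _) ?_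
  refine hJ.initCall (K := [_]) fun l₂ α₂ x₂ hx₂ => ?_
  refine hJ.pure (K := []) [_] [] (pureSteps_client₂ N _ _) ?_
  rw [show x₂ * (x₁ * (a * y)) = x₁ * x₂ * (a * y) by ac_rfl]
  -- Each comparison may extend the lists of known bits, so the induction on `N` must allow
  -- arbitrary ones.
  generalize ([] : List Bool) = bs₁ at hx₁
  generalize ([] : List Bool) = bs₂ at hx₂
  change (J (cmpTimesSubst _ _ N)).holds n _
  induction N generalizing bs₁ bs₂ x₁ x₂ a with
  | zero => exact hval _ _
  | succ N ih =>
    rw [cmpTimesSubst_succ]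
    refine hJ.cmpCall (hA N) (h₀ N [_] α₁ α₂) hx₁ hx₂ ha fun v bs₁' bs₂' x₁' x₂' b h₁ h₂ hb => ?_
    refine hJ.pure (K := []) [_] [] (pureSteps_seq v _) ?_
    exact ih hb _ _ _ h₁ _ h₂

end StepClosed

end

section

/-! ## Couplings -/

namespace SubDistr

variable {A B C : Type*}

theorem tsum_mass_map_fst (ν : SubDistr C) (f : C → A) (g : C → B) (a : A) :
    ∑' b, (ν.map fun c => (f c, g c)).mass (a, b) = (ν.map f).mass a := by
  change ∑' b, ∑' c, ν.mass c * (ret (f c, g c)).mass (a, b) = ∑' c, ν.mass c * (ret (f c)).mass a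
  rw [ENNReal.tsum_comm]
  refine tsum_congr fun c => ?_
  rw [ENNReal.tsum_mul_left, tsum_eq_single (g c) fun b hb => by simp [ret, hb]]
  by_cases h : a = f c
  · rw [h, mass_ret_self, mass_ret_self]
  · rw [mass_ret_ne h, mass_ret_ne fun h' => h (congrArg Prod.fst h')]

theorem tsum_mass_map_snd (ν : SubDistr C) (f : C → A) (g : C → B) (b : B) :
    ∑' a, (ν.map fun c => (f c, g c)).mass (a, b) = (ν.map g).mass b := by
  change ∑' a, ∑' c, ν.mass c * (ret (f c, g c)).mass (a, b) = ∑' c, ν.mass c * (ret (g c)).mass b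
  rw [ENNReal.tsum_comm]
  refine tsum_congr fun c => ?_
  rw [ENNReal.tsum_mul_left, tsum_eq_single (f c) fun b hb => by simp [ret, hb]]
  by_cases h : b = g c
  · rw [h, mass_ret_self, mass_ret_self]
  · rw [mass_ret_ne h, mass_ret_ne fun h' => h (congrArg Prod.snd h')]

/-- A coupling of two images of a distribution. -/
theorem coupl_of_map {ν : SubDistr C} {f : C → A} {g : C → B} {μ₁ : SubDistr A} {μ₂ : SubDistr B}
    (hf : ν.map f = μ₁) (hg : ∀ b, (ν.map g).mass b ≤ μ₂.mass b) :
    μ₁.Coupl μ₂ fun a b => ∃ c, 0 < ν.mass c ∧ a = f c ∧ b = g c := by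
  refine ⟨ν.map fun c => (f c, g c), fun a => ?_, fun b => ?_, fun a b h => ?_⟩
  · rw [tsum_mass_map_fst, hf]
  · rw [tsum_mass_map_snd]
    exact hg b
  · obtain ⟨c, hc, heq⟩ := exists_of_mass_map_pos h
    cases heq
    exact ⟨c, hc, rfl, rfl⟩

theorem Coupl.mono {μ₁ : SubDistr A} {μ₂ : SubDistr B} {R R' : A → B → Prop}
    (h : μ₁.Coupl μ₂ R) (hR : ∀ a b, R a b → R' a b) : μ₁.Coupl μ₂ R' := by
  obtain ⟨μ, h₁, h₂, h₃⟩ := h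
  exact ⟨μ, h₁, h₂, fun a b hp => hR a b (h₃ a b hp)⟩

theorem mass_map_const (ν : SubDistr C) (a b : A) :
    (ν.map fun _ => a).mass b = (ν.expect fun _ => 1) * (ret a).mass b := by
  change ∑' c, ν.mass c * (ret a).mass b = _
  rw [ENNReal.tsum_mul_right, expect_one]

/-- Full mass is essential, because the left marginal has to be exact; in `coupl_ret_right` lost
mass on the right is harmless. -/
theorem coupl_ret_left {μ : SubDistr B} (h : (μ.expect fun _ => 1) = 1) (a : A) :
    (ret a).Coupl μ fun a' b => a' = a ∧ 0 < μ.mass b := by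
  refine (coupl_of_map (ν := μ) (f := fun _ => a) (g := fun b => b) ?_ fun b => ?_).mono ?_
  · ext b
    rw [mass_map_const, h, one_mul]
  · rw [map_id']
  · rintro a b ⟨c, hc, rfl, rfl⟩
    exact ⟨rfl, hc⟩

theorem coupl_ret_right (μ : SubDistr A) (b : B) :
    μ.Coupl (ret b) fun a b' => 0 < μ.mass a ∧ b' = b := by
  refine (coupl_of_map (ν := μ) (f := fun a => a) (g := fun _ => b) (map_id' μ) fun b' => ?_).mono ?_
  · rw [mass_map_const, expect_one]
    exact mul_le_of_le_one_left' μ.sum_le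
  · rintro a b ⟨c, hc, rfl, rfl⟩
    exact ⟨hc, rfl⟩

end SubDistr

/-! ## Proof rules of the refinement weakest precondition -/

namespace IProp

open Res

variable {S : Type}

/-- `P` under the assumption that the resource is valid. -/
def assumeValid (P : IProp S) : IProp S :=
  ⟨fun n x => x.Valid → P.holds n x, fun z hk h hv => P.mono z hk (h hv.of_mul)⟩

variable {M : MarkovChain S} {Φ : Val → IProp S}

theorem rwp_fold (e : Expr) : Entails (rwpF M Φ (fun e => rwp M e Φ) e) (rwp M e Φ) :=
  fun n x hx h W hW => hW e n x hx
    (rwpF_mono M Φ (W := fun e => rwp M e Φ) (fun _ _ _ _ h => h W hW) e n x hx h)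

/-- By monotonicity the map applied to its least fixed point is again a pre-fixed point, and the
least fixed point lies below it. -/
theorem rwp_unfold (e : Expr) : Entails (rwp M e Φ) (rwpF M Φ (fun e => rwp M e Φ) e) :=
  fun _ _ _ h => h _ fun e => rwpF_mono M Φ rwp_fold e

theorem execCoupl_fold {Z : S → Conf → IProp S} (m : S) (ρ : Conf) :
    Entails (cplF M Z (fun p => execCoupl M p.1 p.2 Z) (m, ρ)) (execCoupl M m ρ Z) :=
  fun n x hx h W hW => hW (m, ρ) n x hx
    (cplF_mono M (W := fun p => execCoupl M p.1 p.2 Z) (fun _ _ _ _ _ h => h)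
      (fun _ _ _ _ h => h W hW) (m, ρ) n x hx h)

theorem exists_auth_mul {m : S} {σ : State} {n : ℕ} {y : Res S}
    (h : (sep (specInterp m) (stateInterp σ)).holds n y) : ∃ z, y = auth m σ * z := by
  obtain ⟨_, _, rfl, ⟨z₁, rfl⟩, ⟨z₂, rfl⟩⟩ := h
  exact ⟨z₁ * z₂, mul_mul_mul_comm _ _ _ _⟩

/-- The surplus `z` that comes with the authoritative views and the frame `f` of an update act
together as a single frame `z * f`. -/
theorem compat_of_valid {x z f : Res S} {m : S} {σ : State}
    (h : (x * (auth m σ * z) * f).Valid) : (x * (z * f)).Compat σ m := by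
  rwa [← valid_mul_auth, show x * (z * f) * auth m σ = x * (auth m σ * z) * f by ac_rfl]

theorem valid_of_compat {x z f : Res S} {m : S} {σ : State}
    (h : (x * (z * f)).Compat σ m) : (x * (auth m σ * z) * f).Valid := by
  rwa [← valid_mul_auth, show x * (z * f) * auth m σ = x * (auth m σ * z) * f by ac_rfl] at h

theorem upd_intro {P : IProp S} {n : ℕ} {x : Res S} (h : P.holds n x) : (upd P).holds n x :=
  fun _ hk _ hv => ⟨x, hv, P.mono_index hk h⟩

/-- The predicate that the recursive occurrence in `rwpF` leaves to prove after a step. -/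
theorem upd_interp {m m' : S} {σ σ' : State} {e : Expr} {n : ℕ} {x z : Res S}
    (h : ∀ k ≤ n, ∀ f, (x * (z * f)).Compat σ m →
      ∃ x', (x' * (z * f)).Compat σ' m' ∧ (assumeValid (rwp M e Φ)).holds k x') :
    (upd (upd (sep (specInterp m') (sep (stateInterp σ') (rwp M e Φ))))).holds n
      (x * (auth m σ * z)) := by
  intro k hk f hv
  obtain ⟨x', hc, hJ⟩ := h k hk f (compat_of_valid hv)
  have hv' := valid_of_compat hc
  -- The outer update replaces the fragment and both authoritative views at once; the inner one
  -- changes nothing.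
  refine ⟨_, hv', upd_intro ⟨_, _, ?_, ⟨1, rfl⟩, _, _, rfl, ⟨1, rfl⟩,
    (rwp M e Φ).mono z le_rfl (hJ hv'.of_mul.of_mul)⟩⟩
  simp only [mul_one, auth]
  ac_rfl

/-- The weakest precondition of an expression, from the coupling precondition. -/
theorem rwp_of_execCoupl {e : Expr} (he : ∀ v, e ≠ .val v) {n : ℕ} {x : Res S}
    (h : ∀ k ≤ n, ∀ m σ z, (x * z).Compat σ m →
      (execCoupl M m (e, σ) fun m' ρ' => upd (sep (specInterp m') (sep (stateInterp ρ'.2)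
        (rwp M ρ'.1 Φ)))).holds k (x * (auth m σ * z))) :
    (assumeValid (rwp M e Φ)).holds n x := by
  intro hv
  refine rwp_fold e n x hv (.inr ⟨he, fun m σ k hk y hv hP => ?_⟩)
  obtain ⟨z, rfl⟩ := exists_auth_mul hP
  refine upd_intro (h k hk m σ z ?_)
  have := compat_of_valid (f := 1) (by rwa [mul_one])
  rwa [mul_one] at this

/-- The program steps by the first coupling rule while the model stands still, which costs no later.
`assumeValid` is there because `StepClosed` speaks of arbitrary resources, whereas a least fixed
point can be folded only at valid ones. -/
theorem stepClosed_rwp (M : MarkovChain S) (Φ : Val → IProp S) :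
    StepClosed fun e => assumeValid (rwp M e Φ) := by
  intro e n x he h
  refine rwp_of_execCoupl he fun k hk m σ z hc => ?_
  obtain ⟨h₁, -⟩ := h k hk σ m z hc
  obtain ⟨ρ, hρ⟩ := SubDistr.exists_mass_pos_of_expect_one h₁
  refine execCoupl_fold m (e, σ) k _ ?_ (.inl ⟨_, ⟨⟨ρ, hρ⟩, SubDistr.coupl_ret_left h₁ m⟩, ?_⟩)
  · have := valid_of_compat (f := 1) (x := x) (z := z) (by rwa [mul_one])
    rwa [mul_one] at this
  · rintro _ ⟨e', σ'⟩ ⟨rfl, hp⟩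
    exact upd_interp fun k' hk' f hc' => (h k' (hk'.trans hk) σ _ _ hc').2 e' σ' hp

/-- A step of the model coupled with a step of the program. -/
theorem rwp_coupl {e : Expr} (he : ∀ v, e ≠ .val v) {n : ℕ} {x : Res S}
    (R : S → State → S → Conf → Prop)
    (h : ∀ σ m f, (x * f).Compat σ m →
      (M.Red m ∧ langChain.Red (e, σ) ∧ (M.step m).Coupl (e.step σ) (R m σ)) ∧
      ∀ k < n, ∀ m' e' σ', R m σ m' (e', σ') →
        ∃ x', (x' * f).Compat σ' m' ∧ (assumeValid (rwp M e' Φ)).holds k x') :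
    (assumeValid (rwp M e Φ)).holds n x := by
  refine rwp_of_execCoupl he fun k hk m σ z hc => ?_
  obtain ⟨⟨h₁, h₂, h₃⟩, -⟩ := h σ m z hc
  refine execCoupl_fold m (e, σ) k _ ?_ (.inr (.inl ⟨R m σ, ⟨h₂, h₁, h₃⟩, ?_⟩))
  · have := valid_of_compat (f := 1) (x := x) (z := z) (by rwa [mul_one])
    rwa [mul_one] at this
  · rintro m' ⟨e', σ'⟩ hR k' hk'
    exact upd_interp fun k₀ hk₀ f hc' =>
      (h σ m _ hc').2 k₀ (hk₀.trans_lt (hk'.trans_le hk)) m' e' σ' hR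

/-- A step of the model. -/
theorem rwp_model_step {e : Expr} (he : ∀ v, e ≠ .val v) {n : ℕ} {x : Res S} {m : S}
    (hm : M.Red m)
    (h : ∀ k < n, ∀ m', 0 < (M.step m).mass m' →
      (assumeValid (rwp M e Φ)).holds k (sp m' * x)) :
    (assumeValid (rwp M e Φ)).holds n (sp m * x) := by
  refine rwp_of_execCoupl he fun k hk m₀ σ z hc => ?_
  rw [mul_assoc] at hc
  obtain rfl := (compat_sp_mul.1 hc).1
  refine execCoupl_fold m₀ (e, σ) k _ ?_
    (.inr (.inr (.inl ⟨_, ⟨hm, SubDistr.coupl_ret_right _ _⟩, ?_⟩)))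
  · have := valid_of_compat (f := 1) (x := sp m₀ * x) (z := z) (by rwa [mul_one, mul_assoc])
    rwa [mul_one] at this
  · rintro m' ⟨hm', -⟩ k' hk' k₀ hk₀ f hv
    have hc' := compat_of_valid hv
    rw [mul_assoc] at hc'
    have hc₁ := hc'.sp_update m'
    rw [← mul_assoc] at hc₁
    have hv₁ := valid_of_compat hc₁
    have hv₂ := hv₁.of_mul.of_mul
    -- After the model step the rule asks for a coupling precondition of the same configuration. It
    -- is found by unfolding the weakest precondition at the new model state and supplying it with
    -- the updated authoritative views.
    obtain ⟨v, rfl, -⟩ | ⟨-, H⟩ :=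
      rwp_unfold e k₀ _ hv₂ (h k₀ (hk₀.trans_lt (hk'.trans_le hk)) m' hm' hv₂)
    · exact absurd rfl (he v)
    · have := H m' σ k₀ le_rfl (auth m' σ * z) hv₁.of_mul
        ⟨_, _ * z, mul_assoc _ _ _, ⟨1, (mul_one _).symm⟩, ⟨z, rfl⟩⟩
      exact this k₀ le_rfl f hv₁

theorem rwp_val {v : Val} {n : ℕ} {x : Res S} (h : (Φ v).holds n x) :
    (assumeValid (rwp M (.val v) Φ)).holds n x :=
  fun hv => rwp_fold _ n x hv (.inl ⟨v, rfl, upd_intro h⟩)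

end IProp

end

section

/-! ## The comparison refines an iteration of the model -/

open Res LazyRealCode LazyReal IProp

/-- For fixed `b`, each bit is `b xor c xor d` for exactly two of the four pairs `(c, d)`, so a fair
bit results. -/
theorem expect_unif_xor (F : Fin 2 → ℝ≥0∞) (b : Bool) :
    ((SubDistr.unif (Bool × Bool)).expect fun p => F (bit (b ^^ (p.1 ^^ p.2)))) =
      (SubDistr.unif (Fin 2)).expect F := by
  have h4 : (4 : ℝ≥0∞)⁻¹ * 2 = 2⁻¹ := by
    rw [show (4 : ℝ≥0∞) = 2 * 2 by norm_num, ENNReal.mul_inv (by simp) (by simp), mul_assoc,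
      ENNReal.inv_mul_cancel (by simp) (by simp), mul_one]
  have hc : (Fintype.card (Bool × Bool) : ℝ≥0∞) = 4 := by simp
  rw [SubDistr.expect_unif, SubDistr.expect_unif, hc, Fintype.sum_prod_type, Fin.sum_univ_two]
  simp only [Fintype.sum_bool, Fintype.card_fin, Nat.cast_ofNat, ← h4]
  cases b <;> simp [bit] <;> ring

/-- The token of at least `N` comparisons. -/
def CmpsRes (N : ℕ) (a : Res CmpState) : Prop := ∃ b M, N ≤ M ∧ a = sp ((b, b), M)

theorem CmpsRes.of_succ (N : ℕ) (a : Res CmpState) : CmpsRes (N + 1) a → CmpsRes N a :=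
  fun ⟨b, M, h, ha⟩ => ⟨b, M, N.le_succ.trans h, ha⟩

theorem map_unif_xor {A : Type*} (F : Fin 2 → A) (b : Bool) :
    ((SubDistr.unif (Bool × Bool)).map fun p => F (bit (b ^^ (p.1 ^^ p.2)))) =
      (SubDistr.unif (Fin 2)).map F := by
  ext a
  exact expect_unif_xor (fun i => (SubDistr.ret (F i)).mass a) b

open Expr in
theorem step_fillK_randT_one_nil (K : List ECtxItem) {α : Label} {σ : State}
    (hl : σ.tapes.lookup α = some ⟨1, []⟩) :
    (fillK K (randT (int 1) (val (.lbl α)))).step σ =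
      (SubDistr.unif (Fin 2)).map fun i => (fillK K (int (i.val : ℤ)), σ) := by
  have h : (randT (int 1) (val (.lbl α))).step σ = sample 1 σ := step_randT_nil (N := 1) hl
  rw [step_fillK (by simp), h, sample, SubDistr.map_map]
  rfl

-- The second sampling is coupled with the coin step of the model so that the two bits agree exactly
-- when the two coins do. On agreement the loop continues at a smaller step index, which is what the
-- strong induction needs; on disagreement the model spends its restart step, which turns `N + 1`
-- into `N`.
open Expr in
theorem cmpListSpec_rwp (Φ : Val → IProp CmpState) (n N : ℕ) (K : List ECtxItem)
    (α₁ α₂ : Label) :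
    CmpListSpec (fun e => assumeValid (rwp cmpChain e Φ))
      (fun v => assumeValid (rwp cmpChain (fillK K (val v)) Φ)) n K α₁ α₂
      (CmpsRes (N + 1)) (CmpsRes N) [] [] := by
  have hJ := stepClosed_rwp cmpChain Φ
  induction n using Nat.strong_induction_on with
  | _ n ih =>
  rintro l₁ l₂ x₁ x₂ a y hx₁ hx₂ ⟨b, M, hM, rfl⟩ h
  obtain ⟨M, rfl⟩ : ∃ M', M = M' + 1 := ⟨M - 1, by omega⟩
  refine hJ.cmpList_nil_nil hx₁ hx₂ fun b₁ l₁' x₁' hx₁' => ?_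
  set K' := flipCtx l₂ ++ cmpCtx₂ b₁ l₁' α₁ α₂ :: K
  -- The model pair `p` determines the sampled bit as `b₁ xor p.1 xor p.2`; the tape is empty, so
  -- the program state does not change.
  refine rwp_coupl (fillK_ne_val (by simp) _) (fun _ σ m' ρ' => ∃ p : Bool × Bool,
    m' = (p, M + 1) ∧ ρ' = (fillK K' (int ((bit (b₁ ^^ (p.1 ^^ p.2))).val : ℤ)), σ)) ?_
  intro σ m f hc
  have hc₁ := hc
  rw [show ∀ q r : Res CmpState, q * x₂ * (r * y) * f = r * (q * x₂ * (y * f)) from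
    fun q r => by ac_rfl] at hc₁
  obtain ⟨rfl, -, hc₂⟩ := compat_sp_mul.1 hc₁
  rw [hx₂.eq_of_nil, show ∀ p q r : Res CmpState, r * (p * q) * (y * f) = q * (r * p * (y * f))
    from fun p q r => by ac_rfl] at hc₂
  obtain ⟨hl, -⟩ := compat_tp_mul.1 hc₂
  have hstep := step_fillK_randT_one_nil K' hl
  refine ⟨⟨?_, ?_, ?_⟩, ?_⟩
  · apply SubDistr.exists_mass_pos_of_expect_one
    rw [cmpChain_step_eq, SubDistr.expect_map, SubDistr.expect_unif_one]
  · apply SubDistr.exists_mass_pos_of_expect_one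
    change ((fillK K' _).step σ).expect _ = 1
    rw [hstep, SubDistr.expect_map, SubDistr.expect_unif_one]
  · rw [cmpChain_step_eq, hstep]
    refine (SubDistr.coupl_of_map rfl fun ρ => le_of_eq ?_).mono fun m' ρ' ⟨p, _, hp⟩ => ⟨p, hp⟩
    rw [map_unif_xor (fun i => (fillK K' (int (i.val : ℤ)), σ))]
  · rintro k hk _ e' σ' ⟨p, rfl, heq⟩
    cases heq
    refine ⟨pt l₁ (.someV (node b₁ l₁')) * x₁' * x₂ * (sp (p, M + 1) * y), ?_, ?_⟩
    · have := hc₁.sp_update (p, M + 1)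
      rwa [show ∀ q r : Res CmpState, q * x₂ * (r * y) * f = r * (q * x₂ * (y * f)) from
        fun q r => by ac_rfl]
    have hpost : ∀ v bs₁' bs₂' x₁' x₂' b, LazyRes l₁ α₁ bs₁' x₁' → LazyRes l₂ α₂ bs₂' x₂' →
        CmpsRes N b → (assumeValid (rwp cmpChain (fillK K (val v)) Φ)).holds k
          (x₁' * x₂' * (b * y)) :=
      fun v bs₁' bs₂' x₁' x₂' b h₁ h₂ hb =>
        mono_index _ hk.le (h v bs₁' bs₂' x₁' x₂' b h₁ h₂ hb)
    obtain ⟨c, d⟩ := p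
    by_cases hcd : c = d
    · subst hcd
      -- Equal coins force `b₂ = b₁`. The model is again in an equal pair with the counter
      -- untouched, so the token still bounds `N + 1` comparisons.
      refine hJ.cmpList_sampled (fun _ _ h => h) hx₁' hx₂
        (fun _ => ⟨⟨c, M + 1, hM, rfl⟩, ih k hk⟩) (fun hb => absurd ?_ hb) hpost
      simp
    -- Unequal coins are final for the base chain. The restart to `((true, true), M)` is taken
    -- before the program goes on, so that the comparison ends with the weaker token.
    · rw [mul_left_comm]
      refine rwp_model_step (fillK_ne_val (K := cmpCtx₂ b₁ l₁' α₁ α₂ :: K) (fill_ne_val _ _)) ?_ ?_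
      · apply SubDistr.exists_mass_pos_of_expect_one
        rw [cmpChain_step_ne hcd, SubDistr.expect_ret]
      · intro j hj m' hm'
        rw [cmpChain_step_ne hcd] at hm'
        obtain rfl := SubDistr.eq_of_mass_ret_pos hm'
        rw [mul_left_comm]
        refine hJ.cmpList_sampled (A := CmpsRes (N + 1)) (b₂ := b₁ ^^ (c ^^ d)) (fun _ _ h => h)
          hx₁' hx₂ (fun hb => absurd hb ?_)
          (fun _ => ⟨true, M, by omega, rfl⟩)
          fun v bs₁' bs₂' x₁' x₂' b h₁ h₂ hb =>
            mono_index _ hj.le (hpost v bs₁' bs₂' x₁' x₂' b h₁ h₂ hb)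
        revert hcd
        cases b₁ <;> cases c <;> cases d <;> simp

end

section

/-! ## Almost-sure termination of the comparison -/

open Res LazyRealCode LazyReal IProp

/-- Every state that agrees with the resource terminates with probability at least `t`. -/
noncomputable def termGE (t : ℝ≥0∞) (e : Expr) : IProp CmpState :=
  ⟨fun _ x => ∀ σ m, x.Compat σ m → t ≤ langChain.execTerm (e, σ),
    fun _ _ h σ m hc => h σ m hc.of_mul⟩

/-- The termination probability dominates its mean after one step, and a step of full mass whose
outcomes all satisfy the bound `t` has mean at least `t`. -/
theorem stepClosed_termGE (t : ℝ≥0∞) : StepClosed (termGE t) := by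
  intro e n x he h σ m hc
  obtain ⟨h₁, h₂⟩ := h n le_rfl σ m 1 (by rwa [mul_one])
  refine le_trans ?_ (langChain.expect_execTerm_le (e, σ))
  calc t = (e.step σ).expect fun _ => t := by rw [SubDistr.expect_const, h₁, one_mul]
    _ ≤ _ := SubDistr.expect_mono _ fun ρ hρ => by
      obtain ⟨x', hc', hJ⟩ := h₂ ρ.1 ρ.2 hρ
      exact hJ ρ.2 m (by simpa using hc')

open Expr in
theorem termGE_val (n : ℕ) (v : Val) (x : Res CmpState) : (termGE 1 (val v)).holds n x :=
  fun _ _ _ => langChain.one_le_execTerm_of_final ⟨v, rfl⟩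

-- Let `t` be the best bound not above 1 that holds for all such comparisons whose continuation
-- terminates almost surely. A round differs with probability 1/2, after which the continuation
-- gives 1; otherwise it recurses with bound `t`. Thus `1/2 + t/2` is also a valid bound, and
-- optimality forces `t = 1`. The separate postcondition in `CmpListSpec` keeps the continuation at
-- bound 1 while the call has bound `t`.
open Expr in
theorem cmpListSpec_termGE (n : ℕ) (K : List ECtxItem) (α₁ α₂ : Label) :
    CmpListSpec (termGE 1) (fun v => termGE 1 (fillK K (val v))) n K α₁ α₂
      (fun _ => True) (fun _ => True) [] [] := by
  let T : Set ℝ≥0∞ := {t | CmpListSpec (termGE t) (fun v => termGE 1 (fillK K (val v))) n K α₁ α₂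
      (fun _ => True) (fun _ => True) [] []}
  -- The supremum is attained, since a number above every valid bound is above their supremum.
  have hsup : sSup (T ∩ Set.Iic 1) ∈ T := by
    intro l₁ l₂ x₁ x₂ a y hx₁ hx₂ ha h σ m hc
    exact sSup_le fun t ht => ht.1 l₁ l₂ x₁ x₂ a y hx₁ hx₂ ha h σ m hc
  have hle : sSup (T ∩ Set.Iic 1) ≤ 1 := sSup_le fun t ht => ht.2
  suffices h : sSup (T ∩ Set.Iic 1) = 1 by rwa [h] at hsup
  refine hle.antisymm (ENNReal.one_le_of_half_add_half_le (le_sSup ⟨?_, ?_⟩))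
  swap
  · rw [Set.mem_Iic]
    calc (2⁻¹ : ℝ≥0∞) + 2⁻¹ * sSup (T ∩ Set.Iic 1) ≤ 2⁻¹ + 2⁻¹ * 1 := by gcongr
      _ = 1 := by rw [mul_one, ENNReal.inv_two_add_inv_two]
  generalize sSup (T ∩ Set.Iic 1) = t at hsup hle
  intro l₁ l₂ x₁ x₂ a y hx₁ hx₂ ha h
  refine (stepClosed_termGE _).cmpList_nil_nil hx₁ hx₂ fun b₁ l₁' x₁' hx₁' σ m hc => ?_
  have hc₁ := hc
  rw [hx₂.eq_of_nil, show ∀ p q r z : Res CmpState, r * (p * q) * z = q * (r * p * z)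
    from fun p q r z => by ac_rfl] at hc₁
  -- Here `s` is the bound available once `b₂` is known: `t` if another round is needed, and 1 if
  -- the comparison is decided.
  have key : ∀ b₂ s, (b₁ = b₂ → s = t) → (b₁ ≠ b₂ → s = 1) →
      s ≤ langChain.execTerm (fillK (flipCtx l₂ ++ cmpCtx₂ b₁ l₁' α₁ α₂ :: K)
        (int ((bit b₂).val : ℤ)), σ) := by
    intro b₂ s heq hne
    refine (stepClosed_termGE s).cmpList_sampled (n := n)
      (P := fun v => termGE 1 (fillK K (val v))) (A := fun _ => True) (B := fun _ => True)
      (fun v x hv σ m hc => le_trans ?_ (hv σ m hc)) hx₁' hx₂ (fun hb => ⟨trivial, ?_⟩)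
      (fun _ => trivial) h σ m hc
    · by_cases hb : b₁ = b₂
      · exact (heq hb).trans_le hle
      · exact (hne hb).le
    · rwa [heq hb]
  refine le_trans ?_ (langChain.expect_execTerm_le _)
  change _ ≤ SubDistr.expect ((fillK _ _).step σ) _
  rw [step_fillK_randT_one_nil _ (compat_tp_mul.1 hc₁).1, SubDistr.expect_map,
    SubDistr.expect_unif, Fin.sum_univ_two, Fintype.card_fin, Nat.cast_ofNat, mul_add]
  have hf := key false
  have ht := key true
  cases b₁
  · rw [add_comm (2⁻¹ : ℝ≥0∞)]
    have h₀ := hf t (fun _ => rfl) (by simp)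
    have h₁ := ht 1 (by simp) (fun _ => rfl)
    calc _ = 2⁻¹ * t + 2⁻¹ * 1 := by rw [mul_one]
      _ ≤ _ := add_le_add (mul_le_mul_right h₀ _) (mul_le_mul_right h₁ _)
  · have h₀ := hf 1 (by simp) (fun _ => rfl)
    have h₁ := ht t (fun _ => rfl) (by simp)
    calc _ = 2⁻¹ * 1 + 2⁻¹ * t := by rw [mul_one]
      _ ≤ _ := add_le_add (mul_le_mul_right h₀ _) (mul_le_mul_right h₁ _)

end

-- Representation predicates, Hoare triples and the client

section

open Res LazyRealCode LazyReal IProp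

namespace LazyReal

theorem exists_listRes {l : Loc} {bs : List Bool} {n : ℕ} {x : Res CmpState}
    (h : (isList l bs).holds n x) : ∃ y z, x = y * z ∧ ListRes l bs y := by
  induction bs generalizing l x with
  | nil =>
    obtain ⟨z, rfl⟩ := h
    exact ⟨_, z, rfl, .nil l⟩
  | cons b bs ih =>
    obtain ⟨l', x₁, x₂, rfl, ⟨z₁, rfl⟩, h⟩ := h
    obtain ⟨y, z, rfl, hy⟩ := ih h
    exact ⟨_, z₁ * z, mul_mul_mul_comm _ _ _ _, .cons l b bs l' y hy⟩

theorem isList_of_listRes {l : Loc} {bs : List Bool} (n : ℕ) {x : Res CmpState}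
    (h : ListRes l bs x) : (isList l bs).holds n x := by
  induction h with
  | nil l => exact ⟨1, (mul_one _).symm⟩
  | cons l b bs l' x _ ih => exact ⟨l', _, _, rfl, ⟨1, (mul_one _).symm⟩, ih⟩

/-- Assertions are closed under larger resources, so the exact footprint `y` is split off and the
surplus `z` can travel in the frame. -/
theorem exists_lazyRes {bs : List Bool} {v : Val} {n : ℕ} {x : Res CmpState}
    (h : (lazyReal bs v).holds n x) :
    ∃ l α y z, v = .pairV (.loc l) (.lbl α) ∧ x = y * z ∧ LazyRes l α bs y := by
  obtain ⟨l, α, bs₁, bs₂, x₁, _, rfl, hv, x₂, _, rfl, rfl, x₃, _, rfl, h, ⟨z, rfl⟩⟩ := h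
  obtain ⟨y, z', rfl, hy⟩ := exists_listRes h
  refine ⟨l, α, y * tp α ⟨1, bs₂.map bit⟩, x₁ * x₂ * z' * z, hv, ?_, bs₁, bs₂, y, rfl, hy, rfl⟩
  change x₁ * (x₂ * (y * z' * (tp α _ * z))) = _
  ac_rfl

theorem lazyReal_of_lazyRes {l : Loc} {α : Label} {bs : List Bool} (n : ℕ) {x : Res CmpState}
    (h : LazyRes l α bs x) : (lazyReal bs (.pairV (.loc l) (.lbl α))).holds n x := by
  obtain ⟨bs₁, bs₂, y, rfl, hy, rfl⟩ := h
  exact ⟨l, α, bs₁, bs₂, 1, _, (one_mul _).symm, rfl, 1, _, (one_mul _).symm, rfl,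
    _, _, rfl, isList_of_listRes n hy, 1, (mul_one _).symm⟩

theorem exists_cmpsRes {N n : ℕ} {x : Res CmpState} (h : (cmps N).holds n x) :
    ∃ a z, x = a * z ∧ CmpsRes N a := by
  obtain ⟨b, M, ⟨z, rfl⟩, hM⟩ := h
  exact ⟨_, z, rfl, b, M, hM, rfl⟩

theorem cmps_of_cmpsRes {N : ℕ} (n : ℕ) {a : Res CmpState} (h : CmpsRes N a) :
    (cmps N).holds n a := by
  obtain ⟨b, M, hM, rfl⟩ := h
  exact ⟨b, M, ⟨1, (mul_one _).symm⟩, hM⟩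

end LazyReal

theorem provable_hoare {P : IProp CmpState} {e : Expr} {Φ : Val → IProp CmpState}
    (h : ∀ n x, P.holds n x → (assumeValid (rwp cmpChain e Φ)).holds n x) :
    Provable (hoare cmpChain P e Φ) := by
  intro n x _ _ k _ y hv hP
  rw [one_mul] at hv ⊢
  exact h k y hP hv

theorem hoare_initCall :
    Provable (hoare cmpChain (IProp.pure True) initCall fun v => lazyReal [] v) :=
  provable_hoare fun n x _ =>
    (stepClosed_rwp cmpChain _).initCall (K := []) fun _ _ _ hy =>
      rwp_val ((lazyReal _ _).mono x le_rfl (lazyReal_of_lazyRes n hy))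

theorem hoare_cmpCall (N : ℕ) (bs₁ bs₂ : List Bool) (v₁ v₂ : Val) :
    Provable (hoare cmpChain
      (sep (lazyReal bs₁ v₁) (sep (lazyReal bs₂ v₂) (cmps (N + 1))))
      (cmpCall v₁ v₂)
      fun _ => ex fun bs₁' : List Bool => ex fun bs₂' : List Bool =>
        sep (lazyReal (bs₁ ++ bs₁') v₁) (sep (lazyReal (bs₂ ++ bs₂') v₂) (cmps N))) := by
  refine provable_hoare fun n x h => ?_
  obtain ⟨_, _, rfl, h₁, _, _, rfl, h₂, h₃⟩ := h
  obtain ⟨l₁, α₁, x₁, z₁, rfl, rfl, hx₁⟩ := exists_lazyRes h₁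
  obtain ⟨l₂, α₂, x₂, z₂, rfl, rfl, hx₂⟩ := exists_lazyRes h₂
  obtain ⟨a, z₃, rfl, ha⟩ := exists_cmpsRes h₃
  rw [show x₁ * z₁ * (x₂ * z₂ * (a * z₃)) = x₁ * x₂ * (a * (z₁ * z₂ * z₃)) by ac_rfl]
  refine (stepClosed_rwp cmpChain _).cmpCall (K := []) (CmpsRes.of_succ N)
    (cmpListSpec_rwp _ n N [] α₁ α₂) hx₁ hx₂ ha fun v bs₁' bs₂' x₁' x₂' b hx₁' hx₂' hb =>
      rwp_val ⟨bs₁', bs₂', x₁', x₂' * (b * (z₁ * z₂ * z₃)), mul_assoc _ _ _,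
        lazyReal_of_lazyRes n hx₁', _, _, rfl, lazyReal_of_lazyRes n hx₂',
        (cmps N).mono _ le_rfl (cmps_of_cmpsRes n hb)⟩

theorem rwp_client (N : ℕ) (b : Bool) :
    Entails (spec ((b, b), N)) (rwp cmpChain (client N) fun _ => IProp.pure True) := by
  rintro n _ hv ⟨y, rfl⟩
  exact (stepClosed_rwp cmpChain _).client CmpsRes.of_succ
    (fun N K α₁ α₂ => cmpListSpec_rwp _ n N K α₁ α₂) (fun _ _ => rwp_val trivial)
    (a := sp ((b, b), N)) ⟨b, N, le_rfl, rfl⟩ hv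

theorem one_le_execTerm_client (N : ℕ) (σ : State) : 1 ≤ langChain.execTerm (client N, σ) := by
  have h := (stepClosed_termGE 1).client (n := 0) (A := fun _ _ => True) (fun _ _ _ => trivial)
    (fun _ K α₁ α₂ => cmpListSpec_termGE 0 K α₁ α₂) (fun v x => termGE_val 0 v x) (N := N)
    -- Termination needs no token, so `a` is the unit; the client owns nothing beforehand, and the
    -- whole state serves as its frame.
    (a := 1) (y := Res.ofState σ) trivial
  rw [one_mul] at h
  exact h σ ((true, true), 0) (compat_ofState σ _)

theorem one_le_execTerm_cmpCall {bs₁ bs₂ : List Bool} {v₁ v₂ : Val} {σ : State} {n : ℕ}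
    (h : (sep (lazyReal bs₁ v₁) (lazyReal bs₂ v₂)).holds n (Res.ofState σ)) :
    1 ≤ langChain.execTerm (cmpCall v₁ v₂, σ) := by
  obtain ⟨_, _, hσ, h₁, h₂⟩ := h
  obtain ⟨l₁, α₁, x₁, z₁, rfl, rfl, hx₁⟩ := exists_lazyRes h₁
  obtain ⟨l₂, α₂, x₂, z₂, rfl, rfl, hx₂⟩ := exists_lazyRes h₂
  have := (stepClosed_termGE 1).cmpCall (n := n) (K := []) (fun _ _ => trivial)
    (cmpListSpec_termGE n [] α₁ α₂) (a := 1) (y := z₁ * z₂) hx₁ hx₂ trivial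
    fun v _ _ _ _ _ _ _ _ => termGE_val n v _
  rw [one_mul, mul_mul_mul_comm, ← hσ] at this
  -- The resource owns no part of the model, so any model state is compatible with it.
  exact this σ ((true, true), 0) (compat_ofState σ _)

end

open IProp LazyReal LazyRealCode in
theorem mainTheorem3 :
    -- the specification of `init`
    Provable (hoare cmpChain (pure True) initCall fun v => lazyReal [] v) ∧
    -- the specification of `cmp`
    (∀ (N : ℕ) (bs₁ bs₂ : List Bool) (v₁ v₂ : Val),
      Provable (hoare cmpChain
        (sep (lazyReal bs₁ v₁) (sep (lazyReal bs₂ v₂) (cmps (N + 1))))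
        (cmpCall v₁ v₂)
        fun _ => ex fun bs₁' : List Bool => ex fun bs₂' : List Bool =>
          sep (lazyReal (bs₁ ++ bs₁') v₁) (sep (lazyReal (bs₂ ++ bs₂') v₂) (cmps N)))) ∧
    -- the model and its iterations terminate almost surely
    (∀ p, coinChain.execTerm p = 1) ∧
    (∀ q, cmpChain.execTerm q = 1) ∧
    -- a program that makes `N` comparisons refines the model with `N` iterations and terminates
    -- almost surely
    (∀ (N : ℕ) (b : Bool),
      Entails (spec ((b, b), N)) (rwp cmpChain (client N) fun _ => pure True) ∧
      ∀ σ : State,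
        cmpChain.execTerm ((b, b), N) ≤ langChain.execTerm (client N, σ) ∧
        langChain.execTerm (client N, σ) = 1) ∧
    -- a comparison terminates almost surely in every state that holds the two lazy reals
    (∀ (bs₁ bs₂ : List Bool) (v₁ v₂ : Val) (σ : State),
      (∀ n, (sep (lazyReal bs₁ v₁) (lazyReal bs₂ v₂)).holds n (Res.ofState σ)) →
      (∀ b : Bool, coinChain.execTerm (b, b) ≤ langChain.execTerm (cmpCall v₁ v₂, σ)) ∧
      langChain.execTerm (cmpCall v₁ v₂, σ) = 1) := by
  refine ⟨hoare_initCall, hoare_cmpCall, coinChain_execTerm, cmpChain_execTerm,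
    fun N b => ⟨rwp_client N b, fun σ => ?_⟩, fun bs₁ bs₂ v₁ v₂ σ h => ?_⟩
  · have h := one_le_execTerm_client N σ
    exact ⟨(cmpChain.execTerm_le_one _).trans h, (langChain.execTerm_le_one _).antisymm h⟩
  -- The representation predicates do not depend on the step index, so index 0 carries all the
  -- information.
  · have h := one_le_execTerm_cmpCall (h 0)
    exact ⟨fun b => (coinChain.execTerm_le_one _).trans h,
      (langChain.execTerm_le_one _).antisymm h⟩
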